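/- **Setting.** Let $\mathcal X$ be a measurable input space. Outputs have one of countably many shapes (e.g. lengths): an output of shape $t$ is an element of a product $\mathcal Y_t=\mathcal Y_{t,1}\times\dots\times\mathcal Y_{t,l_t}$ of finite nonempty label sets, and $\mathcal Y=\bigsqcup_t\mathcal Y_t$ (with a single shape, $\mathcal Y=\mathcal Y_1\times\dots\times\mathcal Y_l$). Each input $x$ determines measurably a shape $t(x)$, and the candidate outputs for $x$ are the elements of $\mathcal Y_{t(x)}$. Let $\mathcal D$ be a probability distribution on $\mathcal X\times\mathcal Y$ with $y\in\mathcal Y_{t(x)}$ almost surely. Let $L:\mathcal Y\times\mathcal Y\to[0,\infty)$ be a bounded loss that is definite ($L(y,y')=0$ iff $y=y'$), and put $M=\sup_{y,y'}L(y,y')$ and $\Phi(r)=\min(M,\max(0,r))$. To each example $(x,y)$ is attached an arbitrary factor graph $G(x,y)$: a finite set $F_{(x,y)}$ of factor nodes, each $f\in F_{(x,y)}$ being joined by edges to a set $\mathcal N(f)$ of the substructure indices $\{1,\dots,l_{t(x)}\}$; put $\mathcal Y_f=\prod_{k\in\mathcal N(f)}\mathcal Y_{t(x),k}$ and let $y'_f\in\mathcal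 Y_f$ be the restriction of $y'\in\mathcal Y_{t(x)}$. Let $\Psi:\mathcal X\times\mathcal Y\to\mathbb R^N$ be a feature map, measurable in $x$, that decomposes along these graphs: $\Psi(x,y')=\sum_{f\in F_{(x,y)}}\Psi_f(x,y'_f)$ for every example $(x,y)$ with $y\in\mathcal Y_{t(x)}$ and all $y'\in\mathcal Y_{t(x)}$. For $p\in\{1,2\}$ and $\Lambda_p\in\mathbb R$ let $\mathcal H_p=\{(x,y)\mapsto w\cdot\Psi(x,y): w\in\mathbb R^N,\ \|w\|_p\le\Lambda_p\}$. For a scoring function $h$, let $\mathsf h$ be any measurable predictor with $\mathsf h(x)\in\operatorname{argmax}_{y\in\mathcal Y_{t(x)}}h(x,y)$ (arbitrary tie-breaking) and $R(h)=\mathbb E_{(x,y)\sim\mathcal D}[L(\mathsf h(x),y)]$. For $\rho>0$ and a sample $S=((x_1,y_1),\dots,(x_m,y_m))$, $m\ge1$, let $$\widehat R^{\rm add}_{S,\rho}(h)=\frac1m\sum_{i=1}^m\Phi\Big(\max_{y'\ne y_i}\Big\{L(y',y_i)-\tfrac1\rho[h(x_i,y_i)-h(x_i,y')]\Big\}\Big),$$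 $$\widehat R^{\rm mult}_{S,\rho}(h)=\frac1m\sum_{i=1}^m\Phi\Big(\max_{y'\ne y_i}L(y',y_i)\Big(1-\tfrac1\rho[h(x_i,y_i)-h(x_i,y')]\Big)\Big),$$ where $y'$ ranges over $\mathcal Y_{t(x_i)}$ (the term is $0$ if there is no such $y'$). Write $F_i=F_{(x_i,y_i)}$ and $$r_q=\max_{i,\,f\in F_i,\,u\in\mathcal Y_f}\|\Psi_f(x_i,u)\|_q\quad(q\in\{2,\infty\}),\qquad s=\max_{1\le j\le N}\sum_{i=1}^m\sum_{f\in F_i}\sum_{u\in\mathcal Y_f}|F_i|\,1_{\Psi_{f,j}(x_i,u)\ne0}.$$ **Claim.** Fix $\rho>0$. For any $\delta>0$, with probability at least $1-\delta$ over the draw of $S\sim\mathcal D^m$, the following two inequalities hold for all $h\in\mathcal H_1$: $$R(h)\le\widehat R^{\rm add}_{S,\rho}(h)+\frac{4\sqrt2}{\rho m}\Lambda_1r_\infty\sqrt{s\log(2N)}+3M\sqrt{\frac{\log\frac2\delta}{2m}},$$ $$R(h)\le\widehat R^{\rm mult}_{S,\rho}(h)+\frac{4\sqrt2\,M}{\rho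 m}\Lambda_1r_\infty\sqrt{s\log(2N)}+3M\sqrt{\frac{\log\frac2\delta}{2m}}.$$ Similarly, for any $\delta>0$, with probability at least $1-\delta$ over the draw of $S\sim\mathcal D^m$, the following two inequalities hold for all $h\in\mathcal H_2$: $$R(h)\le\widehat R^{\rm add}_{S,\rho}(h)+\frac{4\sqrt2}{\rho m}\Lambda_2r_2\sqrt{\sum_{i=1}^m\sum_{f\in F_i}\sum_{u\in\mathcal Y_f}|F_i|}+3M\sqrt{\frac{\log\frac2\delta}{2m}},$$ $$R(h)\le\widehat R^{\rm mult}_{S,\rho}(h)+\frac{4\sqrt2\,M}{\rho m}\Lambda_2r_2\sqrt{\sum_{i=1}^m\sum_{f\in F_i}\sum_{u\in\mathcal Y_f}|F_i|}+3M\sqrt{\frac{\log\frac2\delta}{2m}}.$$ -/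

import Mathlib

open MeasureTheory

noncomputable section

/-- A factor graph with variable nodes `1, …, l`, finitely many factor nodes, and a set of edges
between variable nodes and factor nodes. -/
structure FactorGraph (l : ℕ) where
  /-- the number `|F|` of factor nodes -/
  numFactors : ℕ
  /-- the edges, each joining a variable node and a factor node -/
  edges : Finset (Fin l × Fin numFactors)

namespace FactorGraph

variable {l : ℕ}

/-- The factor nodes of `G`. -/
abbrev Factor (G : FactorGraph l) : Type := Fin G.numFactors

/-- The variable nodes joined to the factor node `f` by an edge. -/
def nbhd (G : FactorGraph l) (f : G.Factor) : Finset (Fin l) :=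
  Finset.univ.filter fun k => (k, f) ∈ G.edges

/-- The product of the substructure label sets over the neighbours of the factor node `f`. -/
abbrev LocalOutput (G : FactorGraph l) (𝒴 : Fin l → Type*) (f : G.Factor) :=
  (k : {k // k ∈ G.nbhd f}) → 𝒴 k

/-- The restriction `y_f` of a full labelling `y` to the neighbours of `f`. -/
def restrict (G : FactorGraph l) {𝒴 : Fin l → Type*} (y : (k : Fin l) → 𝒴 k) (f : G.Factor) :
    G.LocalOutput 𝒴 f :=
  fun k => y k

end FactorGraph

/-- The output space. An output has a shape `t` (for instance its length) and then one label for
each of its `l t` substructures. With a single shape this is the product `𝒴₁ × ⋯ × 𝒴ₗ`. -/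
def Output {ι : Type*} (l : ι → ℕ) (𝒴 : (t : ι) → Fin (l t) → Type*) :=
  Σ t : ι, (k : Fin (l t)) → 𝒴 t k

/-- Outputs are discrete. -/
instance {ι : Type*} (l : ι → ℕ) (𝒴 : (t : ι) → Fin (l t) → Type*) :
    MeasurableSpace (Output l 𝒴) := ⊤

section Losses

variable {X ι : Type*} {l : ι → ℕ} {𝒴 : (t : ι) → Fin (l t) → Type*}

/-- The bound `M = sup_{y, y'} L(y, y')` of the loss. -/
def lossBound (L : Output l 𝒴 → Output l 𝒴 → ℝ) : ℝ :=
  ⨆ p : Output l 𝒴 × Output l 𝒴, L p.1 p.2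

/-- Truncation to `[0, M]`. -/
def truncation (M r : ℝ) : ℝ := min M (max 0 r)

/-- `g` is a (measurable) predictor of the scoring function `h`: the value `g x` maximizes
`h x ·` among the outputs of the shape prescribed by `x`; ties are broken arbitrarily. -/
def IsPredictor [MeasurableSpace X] (shape : X → ι) (h : X → Output l 𝒴 → ℝ)
    (g : X → Output l 𝒴) : Prop :=
  Measurable g ∧
    ∀ x, (g x).1 = shape x ∧ ∀ y : Output l 𝒴, y.1 = shape x → h x y ≤ h x (g x)

/-- The generalization error `E_{(x, y) ∼ D} L(g(x), y)` of the predictor `g`. -/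
def risk [MeasurableSpace X] (D : Measure (X × Output l 𝒴)) (L : Output l 𝒴 → Output l 𝒴 → ℝ)
    (g : X → Output l 𝒴) : ℝ :=
  ∫ z, L (g z.1) z.2 ∂D

/-- The additive margin loss of `h` at one example `(x, y)`. The supremum is over the finitely many
outputs `y' ≠ y` of the shape of `x`; if there is none, the loss is `0`. -/
def addMarginLoss (shape : X → ι) (L : Output l 𝒴 → Output l 𝒴 → ℝ) (ρ : ℝ)
    (h : X → Output l 𝒴 → ℝ) (x : X) (y : Output l 𝒴) : ℝ :=
  truncation (lossBound L)
    (⨆ y' : {y' : Output l 𝒴 // y'.1 = shape x ∧ y' ≠ y},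
      (L y'.1 y - (1 / ρ) * (h x y - h x y'.1)))

/-- The multiplicative margin loss of `h` at one example `(x, y)`. -/
def multMarginLoss (shape : X → ι) (L : Output l 𝒴 → Output l 𝒴 → ℝ) (ρ : ℝ)
    (h : X → Output l 𝒴 → ℝ) (x : X) (y : Output l 𝒴) : ℝ :=
  truncation (lossBound L)
    (⨆ y' : {y' : Output l 𝒴 // y'.1 = shape x ∧ y' ≠ y},
      L y'.1 y * (1 - (1 / ρ) * (h x y - h x y'.1)))

/-- The empirical additive margin loss of `h` on the sample `S`. -/
def empAddMarginLoss (shape : X → ι) (L : Output l 𝒴 → Output l 𝒴 → ℝ) (ρ : ℝ) {m : ℕ}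
    (S : Fin m → X × Output l 𝒴) (h : X → Output l 𝒴 → ℝ) : ℝ :=
  (1 / (m : ℝ)) * ∑ i, addMarginLoss shape L ρ h (S i).1 (S i).2

/-- The empirical multiplicative margin loss of `h` on the sample `S`. -/
def empMultMarginLoss (shape : X → ι) (L : Output l 𝒴 → Output l 𝒴 → ℝ) (ρ : ℝ) {m : ℕ}
    (S : Fin m → X × Output l 𝒴) (h : X → Output l 𝒴 → ℝ) : ℝ :=
  (1 / (m : ℝ)) * ∑ i, multMarginLoss shape L ρ h (S i).1 (S i).2

/-- The class `H_p` of linear scoring functions `(x, y) ↦ w · Ψ(x, y)` with `‖w‖_p ≤ Λ`. -/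
def linearClass {N : ℕ} (p : ENNReal) (Ψ : X → Output l 𝒴 → Fin N → ℝ) (Λ : ℝ) :
    Set (X → Output l 𝒴 → ℝ) :=
  {h | ∃ w : Fin N → ℝ, ‖(WithLp.toLp p w : PiLp p fun _ : Fin N => ℝ)‖ ≤ Λ ∧
    h = fun x y => ∑ j, w j * Ψ x y j}

end Losses

section Features

variable {X ι : Type*} {l : ι → ℕ} {𝒴 : (t : ι) → Fin (l t) → Type*} {shape : X → ι} {N : ℕ}

/-- An assignment, to every example `(x, y)`, of a factor graph on the substructures of the shape
of `x`. -/
abbrev GraphFamily (𝒴 : (t : ι) → Fin (l t) → Type*) (shape : X → ι) :=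
  (x : X) → Output l 𝒴 → FactorGraph (l (shape x))

/-- Factor features: a vector `Ψ_f(x, u) ∈ ℝᴺ` for every example `(x, y)`, every factor node `f` of
its factor graph, and every `u` in the local output set of `f`. -/
abbrev FactorFeatures (G : GraphFamily 𝒴 shape) (N : ℕ) :=
  (x : X) → (y : Output l 𝒴) → (f : (G x y).Factor) →
    (G x y).LocalOutput (𝒴 (shape x)) f → Fin N → ℝ

/-- The feature map `Ψ` decomposes along the factor graphs: for every example `(x, y)`, and for
every output `y'` of the shape of `x`, `Ψ(x, y') = ∑_f Ψ_f(x, y'_f)`, where the sum is over the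
factor nodes of the factor graph of `(x, y)`. -/
def Decomposes (G : GraphFamily 𝒴 shape) (Ψ : X → Output l 𝒴 → Fin N → ℝ)
    (Ψf : FactorFeatures G N) : Prop :=
  ∀ (x : X) (y : Output l 𝒴), y.1 = shape x →
    ∀ y' : (k : Fin (l (shape x))) → 𝒴 (shape x) k,
      Ψ x ⟨shape x, y'⟩ = ∑ f, Ψf x y f ((G x y).restrict y' f)

/-- `r_q = max_{i, f, u} ‖Ψ_f(x_i, u)‖_q`. -/
def featureRadius (q : ENNReal) {G : GraphFamily 𝒴 shape} (Ψf : FactorFeatures G N) {m : ℕ}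
    (S : Fin m → X × Output l 𝒴) : ℝ :=
  ⨆ i, ⨆ f, ⨆ u, ‖(WithLp.toLp q (Ψf (S i).1 (S i).2 f u) : PiLp q fun _ : Fin N => ℝ)‖

open Classical in
/-- The sparsity factor `s = max_j ∑_i ∑_{f ∈ F_i} ∑_{u ∈ 𝒴_f} |F_i| 1_{Ψ_{f,j}(x_i, u) ≠ 0}`. -/
def sparsityFactor [∀ t k, Fintype (𝒴 t k)] {G : GraphFamily 𝒴 shape} (Ψf : FactorFeatures G N)
    {m : ℕ} (S : Fin m → X × Output l 𝒴) : ℝ :=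
  ⨆ j : Fin N, ∑ i, ∑ f, ∑ u,
    if Ψf (S i).1 (S i).2 f u j ≠ 0 then ((G (S i).1 (S i).2).numFactors : ℝ) else 0

/-- The total size `∑_i ∑_{f ∈ F_i} ∑_{u ∈ 𝒴_f} |F_i|` of the factor graphs of the sample. -/
def graphSize [∀ t k, Fintype (𝒴 t k)] (G : GraphFamily 𝒴 shape) {m : ℕ}
    (S : Fin m → X × Output l 𝒴) : ℝ :=
  ∑ i, ∑ f : (G (S i).1 (S i).2).Factor,
    ∑ _u : (G (S i).1 (S i).2).LocalOutput (𝒴 (shape (S i).1)) f,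
      ((G (S i).1 (S i).2).numFactors : ℝ)

end Features

end

/-! The loss of a predictor is dominated by the margin loss of its score: a wrong prediction is
itself a competitor with nonpositive margin. It therefore suffices to bound, uniformly over the
weights, the deviation of the mean of the margin loss from its empirical value.

This deviation is at most an empirical Rademacher average plus `3 * M * t`, outside an event of
probability at most `exp (-2 m t ^ 2)`. McDiarmid's inequality is applied once, to the supremum of
the deviations minus the empirical Rademacher average. Symmetrization makes the mean of this
difference nonpositive, and one example changes it by at most `M + 2 * M`. A separate concentration
step for the Rademacher average is thus avoided (`measure_exists_rademacher_add_lt_le`).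

For a fixed sample, the margin loss at an example is Lipschitz in the vector of all local scores,
one for each factor and local labelling. Cauchy-Schwarz over the factors gives each local score the
weight `√|F_i|`, and two labellings select at most two local scores per factor, which costs `√2`
(`abs_sum_sub_le_sqrt`). The vector contraction inequality then replaces the loss by a Rademacher
sum of weighted local scores at the price of another `√2` (`expect_iSup_le_of_lipschitz_vector`).
That constant comes from the sharp `L¹`-`L²` Khintchine inequality, which is deduced from a Poincaré
inequality for even functions on the cube.

What remains is linear in the weights. Duality reduces it to the expected maximum of `2 * N`
subgaussian sums in the `ℓ¹` case, and to the expected Euclidean norm of a Rademacher sum in the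
`ℓ²` case. The additive and multiplicative losses are both instances of `affineMarginLoss`; a union
bound over the two produces `log (2 / δ)`.

The graphs and factor features need not depend measurably on the example: they enter only after the
sample has been fixed. -/

open scoped BigOperators

noncomputable section

/-! ### Analysis on the discrete cube and the sharp Khintchine inequality -/

/-- The sign `±1` encoded by a Boolean. -/
def boolSign (b : Bool) : ℝ := if b then 1 else -1

@[simp] lemma boolSign_true : boolSign true = 1 := rfl

@[simp] lemma boolSign_false : boolSign false = -1 := rfl

@[simp] lemma boolSign_not (b : Bool) : boolSign (!b) = -boolSign b := by
  cases b <;> simp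

lemma boolSign_mul_self (b : Bool) : boolSign b * boolSign b = 1 := by
  cases b <;> simp

lemma abs_boolSign (b : Bool) : |boolSign b| = 1 := by
  cases b <;> simp

lemma expect_bool (f : Bool → ℝ) : 𝔼 b, f b = (f true + f false) / 2 := by
  rw [Fintype.expect_eq_sum_div_card]
  simp

lemma expect_pi_fin_succ {n : ℕ} {α : Fin (n + 1) → Type*} [∀ i, Fintype (α i)]
    (f : (∀ i, α i) → ℝ) :
    𝔼 x, f x = 𝔼 a : α 0, 𝔼 x : ∀ i : Fin n, α i.succ, f (Fin.cons a x) := by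
  rw [← Fintype.expect_equiv (Fin.consEquiv α) (fun p => f (Fin.cons p.1 p.2)) f (fun _ => rfl),
    ← Finset.univ_product_univ, Finset.expect_product]

/-- Flip one coordinate of a point of the cube. -/
def flipAt {K : Type*} [DecidableEq K] (i : K) (x : K → Bool) : K → Bool :=
  Function.update x i (!x i)

lemma flipAt_flipAt {K : Type*} [DecidableEq K] (i : K) (x : K → Bool) :
    flipAt i (flipAt i x) = x := by
  simp [flipAt]

lemma expect_flipAt {K : Type*} [Fintype K] [DecidableEq K] (i : K) (f : (K → Bool) → ℝ) :
    𝔼 x, f (flipAt i x) = 𝔼 x, f x :=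
  Fintype.expect_equiv (Function.Involutive.toPerm (flipAt i) (flipAt_flipAt i)) _ _ fun _ => rfl

lemma expect_antipode {K : Type*} [Fintype K] [DecidableEq K] (f : (K → Bool) → ℝ) :
    𝔼 x : K → Bool, f (fun k => !x k) = 𝔼 x, f x :=
  Fintype.expect_equiv
    (Function.Involutive.toPerm (fun (x : K → Bool) k => !x k) (fun x => by simp)) _ _ fun _ => rfl

/-- The (unnormalized) Dirichlet form of the cube. -/
def cubeEnergy {n : ℕ} (f : (Fin n → Bool) → ℝ) : ℝ := 𝔼 x, ∑ i, (f x - f (flipAt i x)) ^ 2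

lemma flipAt_zero_cons {n : ℕ} (b : Bool) (x : Fin n → Bool) :
    flipAt 0 (Fin.cons b x : Fin (n + 1) → Bool) = (Fin.cons (!b) x : Fin (n + 1) → Bool) := by
  simp [flipAt]

lemma flipAt_succ_cons {n : ℕ} (i : Fin n) (b : Bool) (x : Fin n → Bool) :
    flipAt i.succ (Fin.cons b x : Fin (n + 1) → Bool)
      = (Fin.cons b (flipAt i x) : Fin (n + 1) → Bool) := by
  simp [flipAt, Fin.cons_update]

lemma not_cons {n : ℕ} (b : Bool) (x : Fin n → Bool) :
    (fun k => !(Fin.cons b x : Fin (n + 1) → Bool) k)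
      = (Fin.cons (!b) (fun k => !x k) : Fin (n + 1) → Bool) := by
  funext k
  refine Fin.cases ?_ (fun i => ?_) k <;> simp

section CubeSplit

variable {n : ℕ} (f : (Fin (n + 1) → Bool) → ℝ)

/-- The part of `f` that is even in the first coordinate. -/
def cubeMean (x : Fin n → Bool) : ℝ := (f (Fin.cons true x) + f (Fin.cons false x)) / 2

/-- The part of `f` that is odd in the first coordinate. -/
def cubeDiff (x : Fin n → Bool) : ℝ := (f (Fin.cons true x) - f (Fin.cons false x)) / 2

lemma expect_eq_expect_cubeMean : 𝔼 x, f x = 𝔼 x, cubeMean f x := by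
  rw [expect_pi_fin_succ, expect_bool, ← Finset.expect_add_distrib, Finset.expect_div]
  rfl

lemma expect_sq_eq_cubeMean_cubeDiff :
    𝔼 x, f x ^ 2 = 𝔼 x, cubeMean f x ^ 2 + 𝔼 x, cubeDiff f x ^ 2 := by
  rw [expect_pi_fin_succ, expect_bool, ← Finset.expect_add_distrib, ← Finset.expect_add_distrib,
    Finset.expect_div]
  refine Finset.expect_congr rfl fun x _ => ?_
  simp only [cubeMean, cubeDiff]
  ring

/-- Splitting off the first coordinate drives the inductions on dimension below. Flipping that
coordinate changes `f` by twice its odd part, hence the term with the factor 4; the other flips act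
on the even and odd parts separately. -/
lemma cubeEnergy_succ :
    cubeEnergy f = cubeEnergy (cubeMean f) + cubeEnergy (cubeDiff f)
      + 4 * 𝔼 x, cubeDiff f x ^ 2 := by
  unfold cubeEnergy
  rw [expect_pi_fin_succ, expect_bool, ← Finset.expect_add_distrib, ← Finset.expect_add_distrib,
    Finset.mul_expect, ← Finset.expect_add_distrib, Finset.expect_div]
  refine Finset.expect_congr rfl fun x _ => ?_
  simp only [Fin.sum_univ_succ, flipAt_zero_cons, flipAt_succ_cons, Bool.not_true, Bool.not_false]
  have : ∀ i : Fin n, (f (Fin.cons true x) - f (Fin.cons true (flipAt i x))) ^ 2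
      + (f (Fin.cons false x) - f (Fin.cons false (flipAt i x))) ^ 2
      = 2 * (cubeMean f x - cubeMean f (flipAt i x)) ^ 2
        + 2 * (cubeDiff f x - cubeDiff f (flipAt i x)) ^ 2 := by
    intro i
    simp only [cubeMean, cubeDiff]
    ring
  have h := Finset.sum_congr (rfl : (Finset.univ : Finset (Fin n)) = _) fun i _ => this i
  rw [Finset.sum_add_distrib, Finset.sum_add_distrib, ← Finset.mul_sum, ← Finset.mul_sum] at h
  have e : cubeDiff f x = (f (Fin.cons true x) - f (Fin.cons false x)) / 2 := rfl
  rw [e] at h ⊢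
  linarith [h]

lemma expect_sub_antipode_sq :
    𝔼 x, (f x - f (fun k => !x k)) ^ 2
      = 𝔼 x, (cubeMean f x - cubeMean f (fun k => !x k)) ^ 2
        + 𝔼 x, (cubeDiff f x + cubeDiff f (fun k => !x k)) ^ 2 := by
  have h0 : ∀ x : Fin n → Bool, (fun k => !(fun k => !x k) k) = x := fun x => by simp
  have hanti := expect_antipode (fun x =>
    (cubeMean f x - cubeMean f (fun k => !x k)) * (cubeDiff f x + cubeDiff f (fun k => !x k)))
  -- The cross term is a difference times a sum, so it changes sign under the antipodal map.
  have hcross : 𝔼 x, (cubeMean f x - cubeMean f (fun k => !x k))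
      * (cubeDiff f x + cubeDiff f (fun k => !x k)) = 0 := by
    have : 𝔼 x, (cubeMean f x - cubeMean f (fun k => !x k))
        * (cubeDiff f x + cubeDiff f (fun k => !x k))
        = - 𝔼 x, (cubeMean f x - cubeMean f (fun k => !x k))
        * (cubeDiff f x + cubeDiff f (fun k => !x k)) := by
      conv_lhs => rw [← hanti]
      rw [← Finset.expect_neg_distrib]
      refine Finset.expect_congr rfl fun x _ => ?_
      rw [h0]
      ring
    linarith
  rw [expect_pi_fin_succ, expect_bool]
  simp only [not_cons, Bool.not_true, Bool.not_false]
  have hf := expect_antipode (fun x : Fin n → Bool =>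
    (f (Fin.cons false x) - f (Fin.cons true (fun k => !x k))) ^ 2)
  simp only [Bool.not_not] at hf
  rw [← hf, ← Finset.expect_add_distrib, Finset.expect_div]
  trans 𝔼 x, ((cubeMean f x - cubeMean f (fun k => !x k)) ^ 2
    + (cubeDiff f x + cubeDiff f (fun k => !x k)) ^ 2
    + 2 * ((cubeMean f x - cubeMean f (fun k => !x k))
      * (cubeDiff f x + cubeDiff f (fun k => !x k))))
  swap
  · rw [Finset.expect_add_distrib, Finset.expect_add_distrib, ← Finset.mul_expect, hcross]
    ring
  refine Finset.expect_congr rfl fun x _ => ?_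
  simp only [cubeMean, cubeDiff]
  ring

end CubeSplit

/-- In Fourier terms, a character of degree `k` has energy `4 * k`, while its antipodal difference
contributes 4 for odd `k` and 0 for even `k`. The induction proves this without Fourier expansion.
-/
lemma expect_sub_antipode_sq_le_cubeEnergy {n : ℕ} (f : (Fin n → Bool) → ℝ) :
    𝔼 x, (f x - f (fun k => !x k)) ^ 2 ≤ cubeEnergy f := by
  induction n with
  | zero =>
    have h : ∀ x : Fin 0 → Bool, (fun k => !x k) = x := fun x => Subsingleton.elim _ _
    simp [h, cubeEnergy]
  | succ n ih =>
    rw [expect_sub_antipode_sq, cubeEnergy_succ]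
    have h1 := ih (cubeMean f)
    have h2 : 0 ≤ cubeEnergy (cubeDiff f) :=
      Finset.expect_nonneg fun x _ => Finset.sum_nonneg fun i _ => sq_nonneg _
    have h3 : 𝔼 x, (cubeDiff f x + cubeDiff f (fun k => !x k)) ^ 2
        ≤ 4 * 𝔼 x, cubeDiff f x ^ 2 := by
      have h4 : 4 * 𝔼 x, cubeDiff f x ^ 2
          = 𝔼 x, (2 * cubeDiff f x ^ 2 + 2 * cubeDiff f (fun k => !x k) ^ 2) := by
        rw [Finset.expect_add_distrib, ← Finset.mul_expect, ← Finset.mul_expect,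
          expect_antipode (fun x => cubeDiff f x ^ 2)]
        ring
      rw [h4]
      refine Finset.expect_le_expect fun x _ => ?_
      nlinarith [sq_nonneg (cubeDiff f x - cubeDiff f (fun k => !x k))]
    linarith

/-- A Poincaré inequality on the cube, with the doubled constant for even functions. -/
lemma eight_mul_variance_le_cubeEnergy {n : ℕ} (f : (Fin n → Bool) → ℝ) :
    8 * (𝔼 x, f x ^ 2 - (𝔼 x, f x) ^ 2)
      ≤ cubeEnergy f + 𝔼 x, (f x - f (fun k => !x k)) ^ 2 := by
  induction n with
  | zero =>
    have h : ∀ x : Fin 0 → Bool, (fun k => !x k) = x := fun x => Subsingleton.elim _ _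
    simp [h, cubeEnergy]
  | succ n ih =>
    -- In Fourier terms the claim is that `4 * k + 4 * [k odd] ≥ 8` for `k ≥ 1`. For the odd part
    -- `d`, a parallelogram identity and the previous lemma supply the missing `4 * 𝔼 d ^ 2`.
    rw [expect_sub_antipode_sq, cubeEnergy_succ, expect_sq_eq_cubeMean_cubeDiff,
      expect_eq_expect_cubeMean f]
    have h1 := ih (cubeMean f)
    have h2 := expect_sub_antipode_sq_le_cubeEnergy (cubeDiff f)
    have h3 : 𝔼 x, (cubeDiff f x + cubeDiff f (fun k => !x k)) ^ 2
        + 𝔼 x, (cubeDiff f x - cubeDiff f (fun k => !x k)) ^ 2 = 4 * 𝔼 x, cubeDiff f x ^ 2 := by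
      have h4 : 4 * 𝔼 x, cubeDiff f x ^ 2
          = 𝔼 x, (2 * cubeDiff f x ^ 2 + 2 * cubeDiff f (fun k => !x k) ^ 2) := by
        rw [Finset.expect_add_distrib, ← Finset.mul_expect, ← Finset.mul_expect,
          expect_antipode (fun x => cubeDiff f x ^ 2)]
        ring
      rw [h4, ← Finset.expect_add_distrib]
      refine Finset.expect_congr rfl fun x _ => ?_
      ring
    linarith

lemma expect_boolSign_mul {K : Type*} [Fintype K] [DecidableEq K] (k l : K) :
    𝔼 x : K → Bool, boolSign (x k) * boolSign (x l) = if k = l then 1 else 0 := by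
  split_ifs with h
  · subst h
    simp [boolSign_mul_self]
  · have h1 := expect_flipAt k (fun x => boolSign (x k) * boolSign (x l))
    have h2 : ∀ x : K → Bool, boolSign (flipAt k x k) * boolSign (flipAt k x l)
        = -(boolSign (x k) * boolSign (x l)) := by
      intro x
      simp [flipAt, Ne.symm h]
    simp only [h2, Finset.expect_neg_distrib] at h1
    linarith

lemma expect_sum_boolSign_sq {K : Type*} [Fintype K] [DecidableEq K] (v : K → ℝ) :
    𝔼 x : K → Bool, (∑ k, boolSign (x k) * v k) ^ 2 = ∑ k, v k ^ 2 := by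
  have h : ∀ x : K → Bool, (∑ k, boolSign (x k) * v k) ^ 2
      = ∑ k, ∑ l, (boolSign (x k) * boolSign (x l)) * (v k * v l) := by
    intro x
    rw [sq, Finset.sum_mul_sum]
    refine Finset.sum_congr rfl fun k _ => Finset.sum_congr rfl fun l _ => ?_
    ring
  simp_rw [h, Finset.expect_sum_comm, ← Finset.expect_mul, expect_boolSign_mul]
  simp [sq]

lemma sum_boolSign_flipAt {n : ℕ} (v : Fin n → ℝ) (x : Fin n → Bool) (i : Fin n) :
    ∑ k, boolSign (flipAt i x k) * v k = (∑ k, boolSign (x k) * v k) - 2 * (boolSign (x i) * v i) := by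
  rw [eq_sub_iff_add_eq', ← eq_sub_iff_add_eq, ← Finset.sum_sub_distrib, Finset.sum_eq_single i]
  · simp [flipAt]
    ring
  · intro b _ hb
    simp [flipAt, hb]
  · simp

/-- Khintchine's `L¹`-`L²` inequality with the optimal constant, for `Fin n`. -/
lemma sum_sq_le_two_mul_expect_abs_sq_fin {n : ℕ} (v : Fin n → ℝ) :
    ∑ k, v k ^ 2 ≤ 2 * (𝔼 x : Fin n → Bool, |∑ k, boolSign (x k) * v k|) ^ 2 := by
  set f : (Fin n → Bool) → ℝ := fun x => |∑ k, boolSign (x k) * v k| with hf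
  have hsq : 𝔼 x, f x ^ 2 = ∑ k, v k ^ 2 := by
    simp only [hf, sq_abs]
    exact expect_sum_boolSign_sq v
  have heven : 𝔼 x, (f x - f (fun k => !x k)) ^ 2 = 0 := by
    refine Finset.expect_eq_zero fun x _ => ?_
    have : f (fun k => !x k) = f x := by simp [hf]
    rw [this]
    ring
  -- Triangle inequality: in the sum over all flips each summand keeps its sign `n - 1` times and
  -- reverses it once.
  have hpt : ∀ x, (n - 2 : ℝ) * f x ≤ ∑ i, f (flipAt i x) := by
    intro x
    have h1 : |∑ i, ∑ k, boolSign (flipAt i x k) * v k| ≤ ∑ i, f (flipAt i x) :=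
      Finset.abs_sum_le_sum_abs _ _
    have h2 : ∑ i : Fin n, ∑ k, boolSign (flipAt i x k) * v k
        = (n - 2 : ℝ) * ∑ k, boolSign (x k) * v k := by
      simp_rw [sum_boolSign_flipAt]
      rw [Finset.sum_sub_distrib, ← Finset.mul_sum]
      simp
      ring
    rw [h2, abs_mul] at h1
    exact (mul_le_mul_of_nonneg_right (le_abs_self _) (abs_nonneg _)).trans h1
  -- The energy equals `2 * (n * 𝔼 f² - 𝔼 f * ∑ f ∘ flip)`, of which the pointwise bound leaves `4 *
  -- 𝔼 f²`. With vanishing antipodal difference, the Poincaré inequality becomes `8 * (𝔼 f² - (𝔼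
  -- f)²) ≤ 4 * 𝔼 f²`.
  have hE : cubeEnergy f ≤ 4 * 𝔼 x, f x ^ 2 := by
    have h1 : cubeEnergy f = 2 * n * 𝔼 x, f x ^ 2 - 2 * 𝔼 x, f x * ∑ i, f (flipAt i x) := by
      have : ∀ x, ∑ i, (f x - f (flipAt i x)) ^ 2
          = n * f x ^ 2 - 2 * (f x * ∑ i, f (flipAt i x)) + ∑ i, f (flipAt i x) ^ 2 := by
        intro x
        simp_rw [sub_sq, Finset.sum_add_distrib, Finset.sum_sub_distrib, mul_assoc,
          ← Finset.mul_sum]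
        simp
      unfold cubeEnergy
      simp_rw [this]
      rw [Finset.expect_add_distrib, Finset.expect_sub_distrib, Finset.expect_sum_comm]
      simp_rw [expect_flipAt _ (fun x => f x ^ 2)]
      rw [← Finset.mul_expect, ← Finset.mul_expect]
      simp
      ring
    have h2 : (n - 2 : ℝ) * 𝔼 x, f x ^ 2 ≤ 𝔼 x, f x * ∑ i, f (flipAt i x) := by
      rw [Finset.mul_expect]
      refine Finset.expect_le_expect fun x _ => ?_
      nlinarith [mul_le_mul_of_nonneg_left (hpt x) (abs_nonneg _ : 0 ≤ f x)]
    linarith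
  have := eight_mul_variance_le_cubeEnergy f
  rw [heven] at this
  linarith

/-- Khintchine's `L¹`-`L²` inequality with the optimal constant. -/
lemma sqrt_sum_sq_le_expect_abs {K : Type*} [Fintype K] [DecidableEq K] (v : K → ℝ) :
    √(∑ k, v k ^ 2) ≤ √2 * 𝔼 x : K → Bool, |∑ k, boolSign (x k) * v k| := by
  let e := Fintype.equivFin K
  have h := sum_sq_le_two_mul_expect_abs_sq_fin (fun i => v (e.symm i))
  have h1 : ∑ i, v (e.symm i) ^ 2 = ∑ k, v k ^ 2 := Equiv.sum_comp e.symm (fun k => v k ^ 2)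
  have h2 : 𝔼 x : Fin (Fintype.card K) → Bool, |∑ i, boolSign (x i) * v (e.symm i)|
      = 𝔼 x : K → Bool, |∑ k, boolSign (x k) * v k| := by
    refine Fintype.expect_equiv (e.symm.arrowCongr (Equiv.refl Bool)) _ _ fun x => ?_
    rw [← Equiv.sum_comp e.symm]
    simp
  rw [h1, h2] at h
  have h0 : 0 ≤ 𝔼 x : K → Bool, |∑ k, boolSign (x k) * v k| :=
    Finset.expect_nonneg fun _ _ => abs_nonneg _
  rw [Real.sqrt_le_left (by positivity), mul_pow, Real.sq_sqrt (by norm_num)]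
  exact h

/-! ### Vector contraction for Rademacher averages -/

/-- A real function with bounded absolute value. -/
def IsBoundedFun {T : Type*} (A : T → ℝ) : Prop := ∃ B, ∀ t, |A t| ≤ B

namespace IsBoundedFun

variable {T : Type*} {A B : T → ℝ}

lemma add (hA : IsBoundedFun A) (hB : IsBoundedFun B) : IsBoundedFun fun t => A t + B t := by
  obtain ⟨a, ha⟩ := hA
  obtain ⟨b, hb⟩ := hB
  exact ⟨a + b, fun t => (abs_add_le _ _).trans (add_le_add (ha t) (hb t))⟩

lemma const_mul (hA : IsBoundedFun A) (c : ℝ) : IsBoundedFun fun t => c * A t := by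
  obtain ⟨a, ha⟩ := hA
  exact ⟨|c| * a, fun t => by
    rw [abs_mul]
    exact mul_le_mul_of_nonneg_left (ha t) (abs_nonneg c)⟩

lemma sum {K : Type*} (s : Finset K) {a : K → T → ℝ} (h : ∀ k, IsBoundedFun (a k)) :
    IsBoundedFun fun t => ∑ k ∈ s, a k t := by
  choose b hb using h
  exact ⟨∑ k ∈ s, b k, fun t => (Finset.abs_sum_le_sum_abs _ _).trans
    (Finset.sum_le_sum fun k _ => hb k t)⟩

lemma bddAbove (hA : IsBoundedFun A) : BddAbove (Set.range A) := by
  obtain ⟨a, ha⟩ := hA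
  exact ⟨a, by rintro _ ⟨t, rfl⟩; exact (le_abs_self _).trans (ha t)⟩

lemma le_iSup (hA : IsBoundedFun A) (t : T) : A t ≤ ⨆ t, A t := le_ciSup hA.bddAbove t

end IsBoundedFun

lemma iSup_add_iSup_le {T : Type*} [Nonempty T] {f g : T → ℝ} {c : ℝ}
    (h : ∀ s t, f s + g t ≤ c) : (⨆ t, f t) + ⨆ t, g t ≤ c := by
  rw [← le_sub_iff_add_le]
  refine ciSup_le fun s => ?_
  rw [le_sub_comm]
  exact ciSup_le fun t => by linarith [h s t]

/-- Contraction for one Rademacher variable: it can be exchanged against a Rademacher vector if the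
scalar function is Lipschitz with respect to the vector-valued one. -/
lemma expect_iSup_le_of_lipschitz {T K : Type*} [Nonempty T] [Fintype K] [DecidableEq K]
    {A φ : T → ℝ} {a : K → T → ℝ} {C : ℝ} (hC : 0 ≤ C) (hA : IsBoundedFun A)
    (ha : ∀ k, IsBoundedFun (a k))
    (hlip : ∀ s t, |φ s - φ t| ≤ C * √(∑ k, (a k s - a k t) ^ 2)) :
    𝔼 b, ⨆ t, (A t + boolSign b * φ t)
      ≤ 𝔼 η : K → Bool, ⨆ t, (A t + √2 * C * ∑ k, boolSign (η k) * a k t) := by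
  set X : (K → Bool) → T → ℝ := fun η t => √2 * C * ∑ k, boolSign (η k) * a k t with hX
  have hbdd : ∀ η, IsBoundedFun fun t => A t + X η t := fun η =>
    hA.add ((IsBoundedFun.sum _ fun k => (ha k).const_mul _).const_mul _)
  have hXneg : ∀ η t, X (fun k => !η k) t = -X η t := by
    intro η t
    simp [hX]
  -- Khintchine bounds the increment of `φ` by the mean of `|X η s - X η t|`. For each `η`, this
  -- absolute value is realized by assigning `s` and `t`, in the right order, to the suprema at `η`
  -- and at its antipode.
  have key : ∀ s t, (A s + φ s) + (A t - φ t) ≤ 2 * 𝔼 η, ⨆ t, (A t + X η t) := by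
    intro s t
    have h1 : φ s - φ t ≤ 𝔼 η, |X η s - X η t| := by
      refine (le_abs_self _).trans ((hlip s t).trans ?_)
      refine (mul_le_mul_of_nonneg_left
        (sqrt_sum_sq_le_expect_abs fun k => a k s - a k t) hC).trans ?_
      rw [Finset.mul_expect, Finset.mul_expect]
      refine le_of_eq (Finset.expect_congr rfl fun η _ => ?_)
      simp only [hX, ← mul_sub, ← Finset.sum_sub_distrib]
      rw [abs_mul, abs_of_nonneg (by positivity : 0 ≤ √2 * C)]
      ring
    have h2 : 2 * 𝔼 η, (⨆ t, (A t + X η t))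
        = 𝔼 η, ((⨆ t, (A t + X η t)) + ⨆ t, (A t + X (fun k => !η k) t)) := by
      rw [Finset.expect_add_distrib, expect_antipode (fun η => ⨆ t, (A t + X η t))]
      ring
    have h3 : A s + A t + 𝔼 η, |X η s - X η t|
        ≤ 𝔼 η, ((⨆ t, (A t + X η t)) + ⨆ t, (A t + X (fun k => !η k) t)) := by
      rw [← Fintype.expect_const (ι := K → Bool) (A s + A t), ← Finset.expect_add_distrib]
      refine Finset.expect_le_expect fun η _ => ?_
      have e1 := (hbdd η).le_iSup s
      have e2 := (hbdd η).le_iSup t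
      have e3 := (hbdd fun k => !η k).le_iSup s
      have e4 := (hbdd fun k => !η k).le_iSup t
      simp only [hXneg] at e3 e4 ⊢
      rcases abs_cases (X η s - X η t) with ⟨h, -⟩ | ⟨h, -⟩ <;> rw [h] <;> linarith
    linarith
  rw [expect_bool]
  have := iSup_add_iSup_le (f := fun t => A t + boolSign true * φ t)
    (g := fun t => A t + boolSign false * φ t) (c := 2 * 𝔼 η, ⨆ t, (A t + X η t)) (fun s t => by
      have := key s t
      simp only [boolSign_true, boolSign_false]
      linarith)
  linarith

/-- The vector contraction inequality for Rademacher averages. -/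
theorem expect_iSup_le_of_lipschitz_vector {T : Type*} [Nonempty T] {C : ℝ} (hC : 0 ≤ C) {m : ℕ}
    {K : Fin m → Type*} [∀ i, Fintype (K i)] [∀ i, DecidableEq (K i)]
    {A : T → ℝ} {φ : Fin m → T → ℝ} {a : ∀ i, K i → T → ℝ} (hA : IsBoundedFun A)
    (hφ : ∀ i, IsBoundedFun (φ i)) (ha : ∀ i k, IsBoundedFun (a i k))
    (hlip : ∀ i s t, |φ i s - φ i t| ≤ C * √(∑ k, (a i k s - a i k t) ^ 2)) :
    𝔼 ε : Fin m → Bool, ⨆ t, (A t + ∑ i, boolSign (ε i) * φ i t)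
      ≤ 𝔼 η : ∀ i, K i → Bool, ⨆ t, (A t + √2 * C * ∑ i, ∑ k, boolSign (η i k) * a i k t) := by
  induction m generalizing A with
  | zero => simp
  | succ m ih =>
    rw [expect_pi_fin_succ, expect_pi_fin_succ]
    simp only [Fin.sum_univ_succ, Fin.cons_zero, Fin.cons_succ]
    calc 𝔼 b, 𝔼 ε : Fin m → Bool,
          ⨆ t, (A t + (boolSign b * φ 0 t + ∑ i : Fin m, boolSign (ε i) * φ i.succ t))
        ≤ 𝔼 b, 𝔼 η : ∀ i : Fin m, K i.succ → Bool, ⨆ t, (A t + boolSign b * φ 0 t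
            + √2 * C * ∑ i : Fin m, ∑ k, boolSign (η i k) * a i.succ k t) := by
          refine Finset.expect_le_expect fun b _ => ?_
          simp only [← add_assoc]
          exact ih (hA.add ((hφ 0).const_mul _)) (fun i => hφ i.succ) (fun i => ha i.succ)
            (fun i => hlip i.succ)
      _ = 𝔼 η : ∀ i : Fin m, K i.succ → Bool, 𝔼 b, ⨆ t, ((A t
            + √2 * C * ∑ i : Fin m, ∑ k, boolSign (η i k) * a i.succ k t)
            + boolSign b * φ 0 t) := by
          rw [Finset.expect_comm]
          simp only [add_right_comm]
      -- The sums already exchanged are frozen into the offset, which is why the statements carry an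
      -- arbitrary bounded `A`.
      _ ≤ 𝔼 η : ∀ i : Fin m, K i.succ → Bool, 𝔼 η₀ : K 0 → Bool, ⨆ t, ((A t
            + √2 * C * ∑ i : Fin m, ∑ k, boolSign (η i k) * a i.succ k t)
            + √2 * C * ∑ k, boolSign (η₀ k) * a 0 k t) := by
          refine Finset.expect_le_expect fun η _ => ?_
          have hB : IsBoundedFun fun t =>
              A t + √2 * C * ∑ i : Fin m, ∑ k, boolSign (η i k) * a i.succ k t :=
            hA.add (IsBoundedFun.const_mul (IsBoundedFun.sum _ fun i => IsBoundedFun.sum _ fun k =>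
              IsBoundedFun.const_mul (ha i.succ k) (boolSign (η i k))) (√2 * C))
          exact expect_iSup_le_of_lipschitz hC hB (ha 0) (hlip 0)
      _ = _ := by
          rw [Finset.expect_comm]
          simp only [mul_add, add_assoc, add_comm (√2 * C * ∑ i : Fin m, _)]

/-! ### Moments and maxima of Rademacher sums -/

lemma expect_curry {I : Type*} [Fintype I] [DecidableEq I] {K : I → Type*} [∀ i, Fintype (K i)]
    [∀ i, DecidableEq (K i)] (F : (∀ i, K i → Bool) → ℝ) :
    𝔼 η : ∀ i, K i → Bool, F η = 𝔼 x : (Σ i, K i) → Bool, F (fun i k => x ⟨i, k⟩) :=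
  (Fintype.expect_equiv (Equiv.piCurry fun (i : I) (_ : K i) => Bool) _ _ fun _ => rfl).symm

/-- Independence turns the left side into a product of hyperbolic cosines, each at most `exp (v k ^
2 / 2)`. -/
lemma expect_exp_sum_boolSign_le {K : Type*} [Fintype K] [DecidableEq K] (v : K → ℝ) :
    𝔼 x : K → Bool, Real.exp (∑ k, boolSign (x k) * v k) ≤ Real.exp ((∑ k, v k ^ 2) / 2) := by
  have h : ∑ x : K → Bool, Real.exp (∑ k, boolSign (x k) * v k)
      = ∏ k, (Real.exp (v k) + Real.exp (-v k)) := by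
    have := Finset.prod_univ_sum (fun _ : K => (Finset.univ : Finset Bool))
      (fun k b => Real.exp (boolSign b * v k))
    simp only [Fintype.piFinset_univ, Fintype.sum_bool, boolSign_true, boolSign_false, one_mul,
      neg_mul] at this
    rw [this]
    exact Finset.sum_congr rfl fun x _ => Real.exp_sum _ _
  rw [Fintype.expect_eq_sum_div_card, h]
  have h2 : ∏ k : K, (Real.exp (v k) + Real.exp (-v k)) = 2 ^ Fintype.card K * ∏ k, Real.cosh (v k) := by
    rw [← Finset.card_univ, ← Finset.prod_const, ← Finset.prod_mul_distrib]
    refine Finset.prod_congr rfl fun k _ => ?_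
    rw [Real.cosh_eq]
    ring
  rw [h2, Fintype.card_fun, Fintype.card_bool, Nat.cast_pow, Nat.cast_ofNat,
    mul_div_cancel_left₀ _ (by positivity), Finset.sum_div, Real.exp_sum]
  exact Finset.prod_le_prod (fun k _ => (Real.cosh_pos _).le)
    fun k _ => Real.cosh_le_exp_half_sq (v k)

/-- The maximal inequality for finitely many Rademacher sums. -/
theorem expect_iSup_abs_sum_boolSign_le {J K : Type*} [Fintype J] [Nonempty J] [Fintype K]
    [DecidableEq K] (v : K → J → ℝ) {σ : ℝ} (hσ : 0 ≤ σ) (hv : ∀ j, ∑ k, v k j ^ 2 ≤ σ ^ 2) :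
    𝔼 x : K → Bool, ⨆ j, |∑ k, boolSign (x k) * v k j|
      ≤ σ * √(2 * Real.log (2 * Fintype.card J)) := by
  rcases hσ.eq_or_lt with rfl | hσ
  · have h0 : ∀ k j, v k j = 0 := by
      intro k j
      have h1 := Finset.single_le_sum (f := fun k => v k j ^ 2) (fun k _ => sq_nonneg _)
        (Finset.mem_univ k)
      have h2 := hv j
      have h3 : v k j ^ 2 = 0 := le_antisymm (by simp at h1 h2; linarith) (sq_nonneg _)
      exact pow_eq_zero_iff (two_ne_zero) |>.1 h3
    simp [h0]
  have hN : (1 : ℝ) ≤ Fintype.card J := by exact_mod_cast Fintype.card_pos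
  have hlog : 0 < Real.log (2 * Fintype.card J) := Real.log_pos (by linarith)
  set l := Real.log (2 * Fintype.card J) with hl
  set lam := √(2 * l) / σ with hlam
  have hs : 0 < √(2 * l) := Real.sqrt_pos.2 (by linarith)
  have hlam0 : 0 < lam := div_pos hs hσ
  -- With this `c`, the `2 * card J` exponential moments, each at most `exp (lam ^ 2 * σ ^ 2 / 2)`,
  -- sum to 1 after multiplication by `exp (-c)`. The tangent bound `y + 1 ≤ exp y` at `y = lam *
  -- sup - c` then replaces Jensen's inequality, and `lam` minimizes `c / lam`.
  set c := l + lam ^ 2 * σ ^ 2 / 2 with hc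
  have hpt : ∀ x : K → Bool, lam * (⨆ j, |∑ k, boolSign (x k) * v k j|) + 1 - c
      ≤ ∑ j, Real.exp (-c) * (Real.exp (∑ k, boolSign (x k) * (lam * v k j))
        + Real.exp (∑ k, boolSign (x k) * (-lam * v k j))) := by
    intro x
    obtain ⟨j, hj⟩ := exists_eq_ciSup_of_finite (f := fun j => |∑ k, boolSign (x k) * v k j|)
    rw [← hj]
    refine le_trans ?_ (Finset.single_le_sum (f := fun j => Real.exp (-c) *
      (Real.exp (∑ k, boolSign (x k) * (lam * v k j))
        + Real.exp (∑ k, boolSign (x k) * (-lam * v k j)))) (fun j _ => by positivity)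
      (Finset.mem_univ j))
    have e1 : ∑ k, boolSign (x k) * (lam * v k j) = lam * ∑ k, boolSign (x k) * v k j := by
      rw [Finset.mul_sum]
      exact Finset.sum_congr rfl fun k _ => by ring
    have e2 : ∑ k, boolSign (x k) * (-lam * v k j) = -(lam * ∑ k, boolSign (x k) * v k j) := by
      rw [Finset.mul_sum, ← Finset.sum_neg_distrib]
      exact Finset.sum_congr rfl fun k _ => by ring
    simp only [e1, e2]
    set S := ∑ k, boolSign (x k) * v k j
    have e3 : Real.exp (lam * |S|) ≤ Real.exp (lam * S) + Real.exp (-(lam * S)) := by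
      rcases abs_cases S with ⟨h, -⟩ | ⟨h, -⟩ <;> rw [h]
      · linarith [Real.exp_pos (-(lam * S))]
      · rw [mul_neg]
        linarith [Real.exp_pos (lam * S)]
    have e4 := Real.add_one_le_exp (lam * |S| - c)
    calc lam * |S| + 1 - c = lam * |S| - c + 1 := by ring
      _ ≤ Real.exp (lam * |S| - c) := e4
      _ = Real.exp (-c) * Real.exp (lam * |S|) := by rw [← Real.exp_add]; ring_nf
      _ ≤ _ := mul_le_mul_of_nonneg_left e3 (Real.exp_pos _).le
  have hE := Finset.expect_le_expect (s := Finset.univ) fun x _ => hpt x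
  have hL : 𝔼 x : K → Bool, (lam * (⨆ j, |∑ k, boolSign (x k) * v k j|) + 1 - c)
      = lam * (𝔼 x : K → Bool, ⨆ j, |∑ k, boolSign (x k) * v k j|) + 1 - c := by
    rw [Finset.expect_sub_distrib, Finset.expect_add_distrib, ← Finset.mul_expect]
    simp
  have hmgf : ∀ (μ : ℝ) (j : J), μ ^ 2 = lam ^ 2 →
      𝔼 x : K → Bool, Real.exp (∑ k, boolSign (x k) * (μ * v k j))
        ≤ Real.exp (lam ^ 2 * σ ^ 2 / 2) := by
    intro μ j hμ
    refine (expect_exp_sum_boolSign_le fun k => μ * v k j).trans (Real.exp_le_exp.2 ?_)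
    simp_rw [mul_pow, ← Finset.mul_sum, hμ]
    have := mul_le_mul_of_nonneg_left (hv j) (sq_nonneg lam)
    linarith
  have hR : 𝔼 x : K → Bool, ∑ j, Real.exp (-c) *
      (Real.exp (∑ k, boolSign (x k) * (lam * v k j))
        + Real.exp (∑ k, boolSign (x k) * (-lam * v k j))) ≤ 1 := by
    rw [Finset.expect_sum_comm]
    simp_rw [← Finset.mul_expect, Finset.expect_add_distrib]
    calc _ ≤ ∑ j : J, Real.exp (-c) * (Real.exp (lam ^ 2 * σ ^ 2 / 2)
            + Real.exp (lam ^ 2 * σ ^ 2 / 2)) := by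
          refine Finset.sum_le_sum fun j _ => mul_le_mul_of_nonneg_left ?_ (Real.exp_pos _).le
          exact add_le_add (hmgf _ j rfl) (hmgf _ j (by ring))
      _ = (2 * Fintype.card J) * (Real.exp (-c) * Real.exp (lam ^ 2 * σ ^ 2 / 2)) := by
          rw [Finset.sum_const, Finset.card_univ, nsmul_eq_mul]
          ring
      _ = 1 := by
          rw [← Real.exp_log (show (0 : ℝ) < 2 * Fintype.card J by linarith), ← hl,
            ← Real.exp_add, ← Real.exp_add, hc]
          ring_nf
          simp
  rw [hL] at hE
  have hfin : lam * (𝔼 x : K → Bool, ⨆ j, |∑ k, boolSign (x k) * v k j|) ≤ c := by linarith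
  have hl2 : lam * σ = √(2 * l) := div_mul_cancel₀ _ hσ.ne'
  have hcv : c = lam * (σ * √(2 * l)) := by
    rw [hc, ← mul_pow, hl2, ← mul_assoc, hl2, Real.sq_sqrt (by linarith),
      Real.mul_self_sqrt (by linarith)]
    ring
  rw [hcv] at hfin
  exact le_of_mul_le_mul_left hfin hlam0

lemma expect_sq_le {K : Type*} [Fintype K] [Nonempty K] (f : K → ℝ) :
    (𝔼 x, f x) ^ 2 ≤ 𝔼 x, f x ^ 2 := by
  have h : 0 ≤ 𝔼 x, (f x - 𝔼 y, f y) ^ 2 := Finset.expect_nonneg fun _ _ => sq_nonneg _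
  have h2 : 𝔼 x, (f x - 𝔼 y, f y) ^ 2 = 𝔼 x, f x ^ 2 - (𝔼 y, f y) ^ 2 := by
    set c := 𝔼 y, f y with hc
    have : ∀ x, (f x - c) ^ 2 = f x ^ 2 - f x * (2 * c) + c ^ 2 := fun x => by ring
    simp_rw [this]
    rw [Finset.expect_add_distrib, Finset.expect_sub_distrib, ← Finset.expect_mul, ← hc,
      Fintype.expect_const]
    ring
  linarith

/-- Jensen brings the expectation under the root, where orthogonality of the signs removes the cross
terms. -/
theorem expect_sqrt_sum_sq_boolSign_le {J K : Type*} [Fintype J] [Fintype K] [DecidableEq K]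
    (v : K → J → ℝ) :
    𝔼 x : K → Bool, √(∑ j, (∑ k, boolSign (x k) * v k j) ^ 2) ≤ √(∑ k, ∑ j, v k j ^ 2) := by
  refine Real.le_sqrt_of_sq_le ((expect_sq_le _).trans (le_of_eq ?_))
  rw [Finset.sum_comm]
  simp_rw [Real.sq_sqrt (Finset.sum_nonneg fun _ _ => sq_nonneg _), Finset.expect_sum_comm,
    expect_sum_boolSign_sq]

/-! ### Suprema, finite averages and integrals over product measures -/

section SupremumBounds

variable {T : Type*} [Nonempty T]

lemma abs_iSup_le {f : T → ℝ} {B : ℝ} (h : ∀ t, |f t| ≤ B) : |⨆ t, f t| ≤ B := by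
  have hb : IsBoundedFun f := ⟨B, h⟩
  refine abs_le.2 ⟨?_, ciSup_le fun t => (abs_le.1 (h t)).2⟩
  obtain ⟨t⟩ := ‹Nonempty T›
  exact (abs_le.1 (h t)).1.trans (hb.le_iSup t)

lemma abs_iSup_sub_iSup_le {f g : T → ℝ} {c : ℝ} (hf : BddAbove (Set.range f))
    (hg : BddAbove (Set.range g)) (h : ∀ t, |f t - g t| ≤ c) :
    |(⨆ t, f t) - ⨆ t, g t| ≤ c := by
  refine abs_sub_le_iff.2 ⟨?_, ?_⟩
  · rw [sub_le_iff_le_add]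
    exact ciSup_le fun t => by linarith [(abs_le.1 (h t)).2, le_ciSup hg t]
  · rw [sub_le_iff_le_add]
    exact ciSup_le fun t => by linarith [(abs_le.1 (h t)).1, le_ciSup hf t]

end SupremumBounds

lemma abs_expect_le {K : Type*} [Fintype K] [Nonempty K] {f : K → ℝ} {B : ℝ}
    (h : ∀ k, |f k| ≤ B) : |𝔼 k, f k| ≤ B :=
  (Finset.abs_expect_le _ _).trans (Finset.expect_le Finset.univ_nonempty fun k _ => h k)

lemma Measurable.expect {Z K : Type*} [MeasurableSpace Z] [Fintype K] {f : K → Z → ℝ}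
    (h : ∀ k, Measurable (f k)) : Measurable fun z => 𝔼 k, f k z := by
  simp_rw [Fintype.expect_eq_sum_div_card]
  exact (Finset.measurable_fun_sum _ fun k _ => h k).div_const _

lemma integral_expect {Z K : Type*} [MeasurableSpace Z] {μ : Measure Z} [Fintype K]
    {f : K → Z → ℝ} (h : ∀ k, Integrable (f k) μ) :
    ∫ z, 𝔼 k, f k z ∂μ = 𝔼 k, ∫ z, f k z ∂μ := by
  simp_rw [Fintype.expect_eq_sum_div_card]
  rw [integral_div, integral_finsetSum _ fun k _ => h k]

lemma Measurable.integrable_of_isBoundedFun {Z : Type*} [MeasurableSpace Z] {μ : Measure Z}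
    [IsFiniteMeasure μ] {f : Z → ℝ} (hf : Measurable f) (hb : IsBoundedFun f) : Integrable f μ := by
  obtain ⟨B, hB⟩ := hb
  exact Integrable.of_bound hf.aestronglyMeasurable B (ae_of_all _ hB)

section Product

variable {Z : Type*} [MeasurableSpace Z] {μ : Measure Z} [IsProbabilityMeasure μ] {n : ℕ}

lemma measurable_fin_cons : Measurable fun p : Z × (Fin n → Z) =>
    (Fin.cons p.1 p.2 : Fin (n + 1) → Z) := by
  refine measurable_pi_lambda _ fun i => ?_
  refine Fin.cases ?_ (fun j => ?_) i
  · simpa using measurable_fst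
  · simp only [Fin.cons_succ]
    exact (measurable_pi_apply j).comp measurable_snd

lemma measurable_fin_cons_left (S : Fin n → Z) :
    Measurable fun z : Z => (Fin.cons z S : Fin (n + 1) → Z) :=
  measurable_fin_cons.comp (measurable_id.prodMk measurable_const)

lemma integral_prod_fin_cons (F : (Fin (n + 1) → Z) → ℝ) :
    ∫ p : Z × (Fin n → Z), F (Fin.cons p.1 p.2) ∂(μ.prod (Measure.pi fun _ => μ))
      = ∫ S, F S ∂(Measure.pi fun _ => μ) := by
  have h := (measurePreserving_piFinSuccAbove (fun _ : Fin (n + 1) => μ) 0).symm.integral_comp' F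
  rw [← h]
  exact integral_congr_ae (ae_of_all _ fun p => congrArg F (Fin.insertNth_zero' p.1 p.2).symm)

variable {F : (Fin (n + 1) → Z) → ℝ}

lemma integral_pi_fin_succ (hF : Measurable F) (hb : IsBoundedFun F) :
    ∫ S, F S ∂(Measure.pi fun _ => μ)
      = ∫ z, ∫ S : Fin n → Z, F (Fin.cons z S) ∂(Measure.pi fun _ => μ) ∂μ := by
  rw [← integral_prod_fin_cons, integral_prod]
  obtain ⟨B, hB⟩ := hb
  exact (hF.comp measurable_fin_cons).integrable_of_isBoundedFun ⟨B, fun _ => hB _⟩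

lemma integral_pi_fin_succ_symm (hF : Measurable F) (hb : IsBoundedFun F) :
    ∫ S, F S ∂(Measure.pi fun _ => μ)
      = ∫ S : Fin n → Z, ∫ z, F (Fin.cons z S) ∂μ ∂(Measure.pi fun _ => μ) := by
  rw [← integral_prod_fin_cons, integral_prod_symm]
  obtain ⟨B, hB⟩ := hb
  exact (hF.comp measurable_fin_cons).integrable_of_isBoundedFun ⟨B, fun _ => hB _⟩

lemma measurable_integral_fin_cons_left (hF : Measurable F) :
    Measurable fun S : Fin n → Z => ∫ z, F (Fin.cons z S) ∂μ :=
  ((hF.comp measurable_fin_cons).stronglyMeasurable.integral_prod_left' (μ := μ)).measurable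

lemma measurable_integral_fin_cons_right (hF : Measurable F) :
    Measurable fun z : Z => ∫ S : Fin n → Z, F (Fin.cons z S) ∂(Measure.pi fun _ => μ) :=
  ((hF.comp measurable_fin_cons).stronglyMeasurable.integral_prod_right'
    (ν := Measure.pi fun _ => μ)).measurable

lemma abs_integral_le_of_abs_le {f : Z → ℝ} {B : ℝ} (h : ∀ z, |f z| ≤ B) :
    |∫ z, f z ∂μ| ≤ B := by
  have := norm_integral_le_of_norm_le_const (μ := μ) (f := f) (C := B) (ae_of_all _ h)
  simpa using this

lemma IsBoundedFun.integral {W : Type*} {f : W → Z → ℝ} (h : ∃ B, ∀ w z, |f w z| ≤ B) :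
    IsBoundedFun fun w => ∫ z, f w z ∂μ := by
  obtain ⟨B, hB⟩ := h
  exact ⟨B, fun w => abs_integral_le_of_abs_le (hB w)⟩

lemma integral_mono_of_isBoundedFun {f g : Z → ℝ} (hf : Measurable f) (hg : Measurable g)
    (bf : IsBoundedFun f) (bg : IsBoundedFun g) (h : ∀ z, f z ≤ g z) :
    ∫ z, f z ∂μ ≤ ∫ z, g z ∂μ :=
  integral_mono (hf.integrable_of_isBoundedFun bf) (hg.integrable_of_isBoundedFun bg) h

end Product

/-! ### Bounded differences -/

section McDiarmid

variable {Z : Type*} [MeasurableSpace Z] {μ : Measure Z} [IsProbabilityMeasure μ]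

/-- Hoeffding's lemma: bounded oscillation confines `f` to an interval of length `c` starting at its
infimum. -/
lemma integral_exp_sub_integral_le {f : Z → ℝ} (hf : Measurable f) {c : ℝ}
    (hb : IsBoundedFun f) (hosc : ∀ z z', f z - f z' ≤ c) (lam : ℝ) :
    ∫ z, Real.exp (lam * (f z - ∫ z, f z ∂μ)) ∂μ ≤ Real.exp (lam ^ 2 * c ^ 2 / 8) := by
  have : Nonempty Z := nonempty_of_isProbabilityMeasure μ
  obtain ⟨B, hB⟩ := hb
  have hbelow : BddBelow (Set.range f) := ⟨-B, by rintro _ ⟨z, rfl⟩; exact (abs_le.1 (hB z)).1⟩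
  have hmem : ∀ z, f z ∈ Set.Icc (⨅ z, f z) ((⨅ z, f z) + c) := fun z =>
    ⟨ciInf_le hbelow z, sub_le_iff_le_add.1 (le_ciInf fun z' => by linarith [hosc z z'])⟩
  have h := (ProbabilityTheory.hasSubgaussianMGF_of_mem_Icc (μ := μ) hf.aemeasurable
    (ae_of_all _ hmem)).mgf_le lam
  rw [ProbabilityTheory.mgf] at h
  refine h.trans (le_of_eq ?_)
  congr 1
  simp [div_pow]
  ring

/-- Averaging over the first coordinate preserves bounded differences in the others. With those
fixed, Hoeffding's lemma controls the first coordinate and costs one factor `exp (lam ^ 2 * c ^ 2 /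
8)`. -/
lemma integral_exp_le_of_bounded_differences {n : ℕ} {F : (Fin n → Z) → ℝ} (hF : Measurable F)
    (hb : IsBoundedFun F) {c : ℝ} (hc : ∀ S i z, |F (Function.update S i z) - F S| ≤ c)
    (lam : ℝ) :
    ∫ S, Real.exp (lam * (F S - ∫ S, F S ∂(Measure.pi fun _ => μ))) ∂(Measure.pi fun _ => μ)
      ≤ Real.exp (n * (lam ^ 2 * c ^ 2 / 8)) := by
  induction n with
  | zero =>
    have h : ∀ S, F S = ∫ S, F S ∂(Measure.pi fun _ => μ) := by
      intro S
      have : ∀ S', F S' = F S := fun S' => by rw [Subsingleton.elim S' S]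
      rw [integral_congr_ae (ae_of_all _ this)]
      simp
    simp [fun S => sub_eq_zero.2 (h S)]
  | succ n ih =>
    set G : (Fin n → Z) → ℝ := fun S => ∫ z, F (Fin.cons z S) ∂μ with hG
    have hGm : Measurable G := measurable_integral_fin_cons_left hF
    obtain ⟨B, hB⟩ := hb
    have hGb : IsBoundedFun G := IsBoundedFun.integral ⟨B, fun _ _ => hB _⟩
    have hint : ∀ S : Fin n → Z, Integrable (fun z => F (Fin.cons z S)) μ := fun S =>
      (hF.comp (measurable_fin_cons_left S)).integrable_of_isBoundedFun ⟨B, fun _ => hB _⟩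
    have hGd : ∀ S i z, |G (Function.update S i z) - G S| ≤ c := by
      intro S i z
      simp only [hG]
      rw [← integral_sub (hint _) (hint _)]
      refine abs_integral_le_of_abs_le fun w => ?_
      have := hc (Fin.cons w S) i.succ z
      rwa [← Fin.cons_update] at this
    have hEG : ∫ S, F S ∂(Measure.pi fun _ => μ) = ∫ S, G S ∂(Measure.pi fun _ => μ) :=
      integral_pi_fin_succ_symm hF ⟨B, hB⟩
    set E := ∫ S, F S ∂(Measure.pi fun _ => μ)
    have hexpb : ∀ {W : Type _} {g : W → ℝ}, IsBoundedFun g →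
        IsBoundedFun fun w => Real.exp (lam * (g w - E)) := by
      rintro W g ⟨b, hgb⟩
      refine ⟨Real.exp (|lam| * (b + |E|)), fun w => ?_⟩
      rw [Real.abs_exp]
      refine Real.exp_le_exp.2 ((le_abs_self _).trans ?_)
      rw [abs_mul]
      exact mul_le_mul_of_nonneg_left ((abs_sub _ _).trans (by linarith [hgb w])) (abs_nonneg _)
    have hm : Measurable fun S => Real.exp (lam * (F S - E)) :=
      ((hF.sub_const E).const_mul lam).exp
    rw [integral_pi_fin_succ_symm hm (hexpb ⟨B, hB⟩)]
    have hinner : ∀ S : Fin n → Z, ∫ z, Real.exp (lam * (F (Fin.cons z S) - E)) ∂μ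
        ≤ Real.exp (lam ^ 2 * c ^ 2 / 8) * Real.exp (lam * (G S - E)) := by
      intro S
      have h1 : ∀ z, Real.exp (lam * (F (Fin.cons z S) - E))
          = Real.exp (lam * (F (Fin.cons z S) - G S)) * Real.exp (lam * (G S - E)) := by
        intro z
        rw [← Real.exp_add]
        ring_nf
      simp_rw [h1]
      rw [integral_mul_const]
      refine mul_le_mul_of_nonneg_right ?_ (Real.exp_pos _).le
      refine integral_exp_sub_integral_le (hF.comp (measurable_fin_cons_left S))
        ⟨B, fun _ => hB _⟩ (fun z z' => ?_) lam
      have h2 := hc (Fin.cons z' S) 0 z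
      rw [Fin.update_cons_zero] at h2
      exact (le_abs_self _).trans h2
    have h3 := ih hGm hGb hGd
    rw [← hEG] at h3
    have hGe : Measurable fun S => Real.exp (lam * (G S - E)) :=
      ((hGm.sub_const E).const_mul lam).exp
    calc ∫ S : Fin n → Z, ∫ z, Real.exp (lam * (F (Fin.cons z S) - E)) ∂μ ∂(Measure.pi fun _ => μ)
        ≤ ∫ S : Fin n → Z, Real.exp (lam ^ 2 * c ^ 2 / 8) * Real.exp (lam * (G S - E))
            ∂(Measure.pi fun _ => μ) := by
          obtain ⟨b, hbb⟩ := hexpb ⟨B, hB⟩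
          exact integral_mono_of_isBoundedFun (measurable_integral_fin_cons_left hm)
            (hGe.const_mul _) (IsBoundedFun.integral ⟨b, fun _ _ => hbb _⟩)
            ((hexpb hGb).const_mul _) hinner
      _ ≤ Real.exp (lam ^ 2 * c ^ 2 / 8) * Real.exp (n * (lam ^ 2 * c ^ 2 / 8)) := by
          rw [integral_const_mul]
          exact mul_le_mul_of_nonneg_left h3 (Real.exp_pos _).le
      _ = _ := by
          rw [← Real.exp_add]
          push_cast
          ring_nf

/-- McDiarmid's bounded differences inequality. -/
theorem measureReal_ge_le_of_bounded_differences {n : ℕ} {F : (Fin n → Z) → ℝ}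
    (hF : Measurable F) (hb : IsBoundedFun F) {c : ℝ}
    (hc : ∀ S i z, |F (Function.update S i z) - F S| ≤ c) {s : ℝ} (hs : 0 ≤ s) :
    (Measure.pi fun _ : Fin n => μ).real
        {S | s ≤ F S - ∫ S, F S ∂(Measure.pi fun _ => μ)}
      ≤ Real.exp (-s ^ 2 / (n * c ^ 2 / 2)) := by
  set E := ∫ S, F S ∂(Measure.pi fun _ => μ) with hE
  -- The variance proxy is `n * c ^ 2 / 4`; the Chernoff bound for it gives the exponent.
  have h : ProbabilityTheory.HasSubgaussianMGF (fun S => F S - E)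
      (n * (‖c‖₊ / 2) ^ 2) (Measure.pi fun _ : Fin n => μ) := by
    refine ⟨fun t => ?_, fun t => ?_⟩
    · obtain ⟨B, hB⟩ := hb
      refine ProbabilityTheory.integrable_exp_mul_of_mem_Icc (a := -(B + |E|)) (b := B + |E|)
        (hF.sub_const E).aemeasurable (ae_of_all _ fun S => ?_)
      exact abs_le.1 ((abs_sub _ _).trans (by linarith [hB S]))
    · refine (integral_exp_le_of_bounded_differences hF hb hc t).trans (le_of_eq ?_)
      congr 1
      simp [div_pow]
      ring
  refine (h.measure_ge_le hs).trans (le_of_eq ?_)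
  congr 2
  simp [div_pow]
  ring

end McDiarmid

/-! ### Symmetrization and uniform deviation -/

section Symmetrization

variable {Z T : Type*} [MeasurableSpace Z] {μ : Measure Z} [IsProbabilityMeasure μ] [Nonempty T]
  [Countable T] {f : T → Z → ℝ} {M : ℝ}

/-- No ghost sample is needed: the bracket is the average of `A k + 2 * ∫ f k` and `A k - 2 * f k
z`. The first is at most the mean supremum for the sign `+1`, the second at most the pointwise
supremum for the sign `-1`. -/
lemma integral_iSup_integral_sub_le (hf : ∀ k, Measurable (f k)) (hM : ∀ k z, |f k z| ≤ M)
    {A : T → ℝ} (hA : IsBoundedFun A) :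
    ∫ z, ⨆ k, (A k + (∫ z, f k z ∂μ - f k z)) ∂μ
      ≤ ∫ z, 𝔼 b, ⨆ k, (A k + 2 * boolSign b * f k z) ∂μ := by
  obtain ⟨a, ha⟩ := hA
  have hE : ∀ k, |∫ z, f k z ∂μ| ≤ M := fun k => abs_integral_le_of_abs_le (hM k)
  have hb : ∀ (b : Bool) z k, |A k + 2 * boolSign b * f k z| ≤ a + 2 * M := by
    intro b z k
    refine (abs_add_le _ _).trans (add_le_add (ha k) ?_)
    rw [abs_mul, abs_mul, abs_boolSign]
    norm_num
    exact hM k z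
  have hm : ∀ b : Bool, Measurable fun z => ⨆ k, (A k + 2 * boolSign b * f k z) := fun b =>
    Measurable.iSup fun k => ((hf k).const_mul _).const_add _
  have hbs : ∀ b : Bool, IsBoundedFun fun z => ⨆ k, (A k + 2 * boolSign b * f k z) := fun b =>
    ⟨a + 2 * M, fun z => abs_iSup_le (hb b z)⟩
  have hi : ∀ b : Bool, Integrable (fun z => ⨆ k, (A k + 2 * boolSign b * f k z)) μ := fun b =>
    (hm b).integrable_of_isBoundedFun (hbs b)
  rw [integral_expect hi, expect_bool]
  set P := ∫ z, ⨆ k, (A k + 2 * boolSign true * f k z) ∂μ with hP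
  have hpt : ∀ z, ⨆ k, (A k + (∫ z, f k z ∂μ - f k z))
      ≤ P / 2 + (1 / 2) * ⨆ k, (A k + 2 * boolSign false * f k z) := by
    intro z
    refine ciSup_le fun k => ?_
    have h1 : A k + 2 * ∫ z, f k z ∂μ ≤ P := by
      have : A k + 2 * ∫ z, f k z ∂μ = ∫ z, (A k + 2 * boolSign true * f k z) ∂μ := by
        rw [integral_add (integrable_const _)
          (((hf k).integrable_of_isBoundedFun ⟨M, hM k⟩).const_mul _), integral_const_mul]
        simp
      rw [this]
      refine integral_mono_of_isBoundedFun (((hf k).const_mul _).const_add _) (hm true)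
        ⟨a + 2 * M, fun z => hb true z k⟩ (hbs true) fun z => ?_
      exact IsBoundedFun.le_iSup (A := fun k => A k + 2 * boolSign true * f k z) ⟨_, hb true z⟩ k
    have h2 := IsBoundedFun.le_iSup (A := fun k => A k + 2 * boolSign false * f k z)
      ⟨_, hb false z⟩ k
    simp only [boolSign_false] at h2 ⊢
    generalize (⨆ k, (A k + 2 * -1 * f k z)) = N at h2 ⊢
    generalize (∫ z, f k z ∂μ) = I at h1 ⊢
    generalize f k z = J at h2 ⊢
    linarith
  calc _ ≤ ∫ z, (P / 2 + (1 / 2) * ⨆ k, (A k + 2 * boolSign false * f k z)) ∂μ := by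
        refine integral_mono_of_isBoundedFun ?_ (((hm false).const_mul _).const_add _) ?_ ?_ hpt
        · exact Measurable.iSup fun k => ((hf k).const_sub _).const_add _
        · refine ⟨a + (M + M), fun z => abs_iSup_le fun k => ?_⟩
          exact (abs_add_le _ _).trans (add_le_add (ha k)
            ((abs_sub _ _).trans (add_le_add (hE k) (hM k z))))
        · exact IsBoundedFun.add ⟨|P / 2|, fun _ => le_rfl⟩ ((hbs false).const_mul _)
    _ = _ := by
        rw [integral_add (integrable_const _) ((hi false).const_mul _), integral_const_mul]
        simp
        ring

/-- Symmetrization of the one-sided uniform deviation. -/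
theorem integral_iSup_sum_integral_sub_le (hf : ∀ k, Measurable (f k))
    (hM : ∀ k z, |f k z| ≤ M) {n : ℕ} {A : T → ℝ} (hA : IsBoundedFun A) :
    ∫ S : Fin n → Z, ⨆ k, (A k + ∑ i, (∫ z, f k z ∂μ - f k (S i))) ∂(Measure.pi fun _ => μ)
      ≤ ∫ S : Fin n → Z, 𝔼 ε : Fin n → Bool, ⨆ k, (A k + ∑ i, 2 * boolSign (ε i) * f k (S i))
          ∂(Measure.pi fun _ => μ) := by
  have hE : ∀ k, |∫ z, f k z ∂μ| ≤ M := fun k => abs_integral_le_of_abs_le (hM k)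
  have hd : ∀ k z, |∫ z, f k z ∂μ - f k z| ≤ 2 * M := fun k z =>
    (abs_sub _ _).trans (by linarith [hE k, hM k z])
  have hs : ∀ (b : Bool) k z, |2 * boolSign b * f k z| ≤ 2 * M := by
    intro b k z
    rw [abs_mul, abs_mul, abs_boolSign]
    norm_num
    exact hM k z
  induction n generalizing A with
  | zero => simp
  | succ n ih =>
    obtain ⟨a, ha⟩ := hA
    have hsum : ∀ {n : ℕ} {g : Fin n → ℝ}, (∀ i, |g i| ≤ 2 * M) → |∑ i, g i| ≤ n * (2 * M) := by
      intro n g h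
      refine (Finset.abs_sum_le_sum_abs _ _).trans ?_
      simpa using Finset.sum_le_sum fun i (_ : i ∈ Finset.univ) => h i
    set L : (Fin (n + 1) → Z) → ℝ :=
      fun S => ⨆ k, (A k + ∑ i, (∫ z, f k z ∂μ - f k (S i)))
    -- A hybrid of the two sides: the first example is still centred, the others already carry
    -- signs.
    set H : (Fin (n + 1) → Z) → ℝ := fun S => 𝔼 ε : Fin n → Bool,
      ⨆ k, ((A k + (∫ z, f k z ∂μ - f k (S 0))) + ∑ i, 2 * boolSign (ε i) * f k (S i.succ))
    set R : (Fin (n + 1) → Z) → ℝ := fun S => 𝔼 ε : Fin (n + 1) → Bool,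
      ⨆ k, (A k + ∑ i, 2 * boolSign (ε i) * f k (S i))
    have hLm : Measurable L := by
      refine Measurable.iSup fun k => Measurable.const_add (Finset.measurable_fun_sum _ fun i _ => ?_) _
      exact ((hf k).comp (measurable_pi_apply i)).const_sub _
    have hHm : Measurable H := by
      refine Measurable.expect fun ε => Measurable.iSup fun k => Measurable.add ?_
        (Finset.measurable_fun_sum _ fun i _ => ?_)
      · exact (((hf k).comp (measurable_pi_apply 0)).const_sub _).const_add _
      · exact ((hf k).comp (measurable_pi_apply i.succ)).const_mul _
    have hRm : Measurable R := by
      refine Measurable.expect fun ε => Measurable.iSup fun k => Measurable.const_add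
        (Finset.measurable_fun_sum _ fun i _ => ?_) _
      exact ((hf k).comp (measurable_pi_apply i)).const_mul _
    have hLb : ∀ S, |L S| ≤ a + (n + 1 : ℕ) * (2 * M) := fun S => abs_iSup_le fun k =>
      (abs_add_le _ _).trans (add_le_add (ha k) (hsum fun i => hd k _))
    have hHb : ∀ S, |H S| ≤ (a + 2 * M) + n * (2 * M) := fun S => abs_expect_le fun ε =>
      abs_iSup_le fun k => (abs_add_le _ _).trans (add_le_add
        ((abs_add_le _ _).trans (add_le_add (ha k) (hd k _))) (hsum fun i => hs _ k _))
    have hRb : ∀ S, |R S| ≤ a + (n + 1 : ℕ) * (2 * M) := fun S => abs_expect_le fun ε =>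
      abs_iSup_le fun k => (abs_add_le _ _).trans (add_le_add (ha k) (hsum fun i => hs _ k _))
    calc ∫ S, L S ∂(Measure.pi fun _ => μ) ≤ ∫ S, H S ∂(Measure.pi fun _ => μ) := by
          rw [integral_pi_fin_succ hLm ⟨_, hLb⟩, integral_pi_fin_succ hHm ⟨_, hHb⟩]
          refine integral_mono_of_isBoundedFun (measurable_integral_fin_cons_right hLm)
            (measurable_integral_fin_cons_right hHm) (IsBoundedFun.integral ⟨_, fun _ _ => hLb _⟩)
            (IsBoundedFun.integral ⟨_, fun _ _ => hHb _⟩) fun z => ?_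
          have := ih (A := fun k => A k + (∫ z, f k z ∂μ - f k z))
            ⟨a + 2 * M, fun k => (abs_add_le _ _).trans (add_le_add (ha k) (hd k z))⟩
          simpa only [L, H, Fin.sum_univ_succ, Fin.cons_zero, Fin.cons_succ, add_assoc] using this
      _ ≤ ∫ S, R S ∂(Measure.pi fun _ => μ) := by
          rw [integral_pi_fin_succ_symm hHm ⟨_, hHb⟩, integral_pi_fin_succ_symm hRm ⟨_, hRb⟩]
          refine integral_mono_of_isBoundedFun (measurable_integral_fin_cons_left hHm)
            (measurable_integral_fin_cons_left hRm) (IsBoundedFun.integral ⟨_, fun _ _ => hHb _⟩)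
            (IsBoundedFun.integral ⟨_, fun _ _ => hRb _⟩) fun S => ?_
          simp only [H, R, Fin.cons_zero, Fin.cons_succ]
          have hAb : ∀ (ε : Fin n → Bool) k,
              |A k + ∑ i, 2 * boolSign (ε i) * f k (S i)| ≤ a + n * (2 * M) := fun ε k =>
            (abs_add_le _ _).trans (add_le_add (ha k) (hsum fun i => hs _ k _))
          have hi1 : ∀ ε : Fin n → Bool, Integrable (fun z => ⨆ k,
              (A k + (∫ z, f k z ∂μ - f k z) + ∑ i, 2 * boolSign (ε i) * f k (S i))) μ := by
            intro ε
            refine Measurable.integrable_of_isBoundedFun (Measurable.iSup fun k =>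
              (((hf k).const_sub _).const_add _).add_const _)
              ⟨(a + n * (2 * M)) + 2 * M, fun z => abs_iSup_le fun k => ?_⟩
            rw [add_right_comm]
            exact (abs_add_le _ _).trans (add_le_add (hAb ε k) (hd k z))
          have hi2 : ∀ ε : Fin n → Bool, Integrable (fun z => 𝔼 b, ⨆ k,
              (A k + ∑ i, 2 * boolSign (ε i) * f k (S i) + 2 * boolSign b * f k z)) μ := by
            intro ε
            refine Measurable.integrable_of_isBoundedFun (Measurable.expect fun b =>
              Measurable.iSup fun k => ((hf k).const_mul _).const_add _)
              ⟨(a + n * (2 * M)) + 2 * M, fun z => abs_expect_le fun b => abs_iSup_le fun k => ?_⟩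
            exact (abs_add_le _ _).trans (add_le_add (hAb ε k) (hs b k z))
          rw [integral_expect hi1]
          have hR' : ∀ z, (𝔼 ε : Fin (n + 1) → Bool, ⨆ k,
              (A k + ∑ i, 2 * boolSign (ε i) * f k ((Fin.cons z S : Fin (n + 1) → Z) i)))
              = 𝔼 ε : Fin n → Bool, 𝔼 b, ⨆ k,
                (A k + ∑ i, 2 * boolSign (ε i) * f k (S i) + 2 * boolSign b * f k z) := by
            intro z
            rw [expect_pi_fin_succ, Finset.expect_comm]
            simp only [Fin.sum_univ_succ, Fin.cons_zero, Fin.cons_succ, add_assoc,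
              add_comm (2 * boolSign _ * f _ z)]
          simp only [hR']
          rw [integral_expect hi2]
          refine Finset.expect_le_expect fun ε _ => ?_
          have := integral_iSup_integral_sub_le hf hM (μ := μ) ⟨_, hAb ε⟩
          simpa only [add_right_comm] using this

end Symmetrization

lemma sum_update_sub_sum {Z : Type*} {n : ℕ} (g : Fin n → Z → ℝ) (S : Fin n → Z) (i : Fin n)
    (z : Z) : ∑ j, g j (Function.update S i z j) - ∑ j, g j (S j) = g i z - g i (S i) := by
  rw [← Finset.sum_sub_distrib, Finset.sum_eq_single i]
  · simp
  · intro j _ hj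
    simp [hj]
  · simp

/-- One-sided uniform deviation bound with the empirical Rademacher average. -/
theorem measure_exists_rademacher_add_lt_le {Z T : Type*} [MeasurableSpace Z] {μ : Measure Z}
    [IsProbabilityMeasure μ] [Nonempty T] [Countable T] {f : T → Z → ℝ} {M : ℝ}
    (hf : ∀ k, Measurable (f k)) (hf0 : ∀ k z, 0 ≤ f k z) (hfM : ∀ k z, f k z ≤ M) {n : ℕ}
    (hn : 0 < n) {t : ℝ} (ht : 0 ≤ t) :
    (Measure.pi fun _ : Fin n => μ) {S | ∃ k,
        (𝔼 ε : Fin n → Bool, ⨆ k, ∑ i, 2 * boolSign (ε i) * f k (S i)) + 3 * M * n * t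
          < ∑ i, (∫ z, f k z ∂μ - f k (S i))}
      ≤ ENNReal.ofReal (Real.exp (-(2 * n * t ^ 2))) := by
  have hZ : Nonempty Z := nonempty_of_isProbabilityMeasure μ
  have hM0 : 0 ≤ M := by
    obtain ⟨z⟩ := hZ
    obtain ⟨k⟩ := ‹Nonempty T›
    exact (hf0 k z).trans (hfM k z)
  -- For `M = 0` the McDiarmid exponent would divide by zero, but the strict inequality defining the
  -- event then fails.
  rcases hM0.eq_or_lt with rfl | hMpos
  · have h0 : ∀ k z, f k z = 0 := fun k z => le_antisymm (hfM k z) (hf0 k z)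
    simp [h0]
  have hM : ∀ k z, |f k z| ≤ M := fun k z => by
    rw [abs_of_nonneg (hf0 k z)]
    exact hfM k z
  have hE : ∀ k, |∫ z, f k z ∂μ| ≤ M := fun k => abs_integral_le_of_abs_le (hM k)
  have hfd : ∀ k z z', |f k z - f k z'| ≤ M := fun k z z' =>
    abs_sub_le_iff.2 ⟨by linarith [hf0 k z', hfM k z], by linarith [hf0 k z, hfM k z']⟩
  have hsum : ∀ {g : Fin n → ℝ}, (∀ i, |g i| ≤ 2 * M) → |∑ i, g i| ≤ n * (2 * M) := by
    intro g h
    refine (Finset.abs_sum_le_sum_abs _ _).trans ?_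
    simpa using Finset.sum_le_sum fun i (_ : i ∈ Finset.univ) => h i
  set P : (Fin n → Z) → ℝ := fun S => ⨆ k, ∑ i, (∫ z, f k z ∂μ - f k (S i)) with hP
  set Q : (Fin n → Z) → ℝ :=
    fun S => 𝔼 ε : Fin n → Bool, ⨆ k, ∑ i, 2 * boolSign (ε i) * f k (S i) with hQ
  have hPb' : ∀ (S : Fin n → Z) k, |∑ i, (∫ z, f k z ∂μ - f k (S i))| ≤ n * (2 * M) := fun (S : Fin n → Z) k =>
    hsum fun i => (abs_sub _ _).trans (by linarith [hE k, hM k (S i)])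
  have hQb' : ∀ (ε : Fin n → Bool) (S : Fin n → Z) k,
      |∑ i, 2 * boolSign (ε i) * f k (S i)| ≤ n * (2 * M) := fun ε S k => hsum fun i => by
    rw [abs_mul, abs_mul, abs_boolSign]
    norm_num
    exact hM k _
  have hPm : Measurable P := Measurable.iSup fun k => Finset.measurable_fun_sum _ fun i _ =>
    ((hf k).comp (measurable_pi_apply i)).const_sub _
  have hQm : Measurable Q := Measurable.expect fun ε => Measurable.iSup fun k =>
    Finset.measurable_fun_sum _ fun i _ => ((hf k).comp (measurable_pi_apply i)).const_mul _
  have hPb : IsBoundedFun P := ⟨_, fun S => abs_iSup_le (hPb' S)⟩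
  have hQb : IsBoundedFun Q := ⟨_, fun S => abs_expect_le fun ε => abs_iSup_le (hQb' ε S)⟩
  have hFb : IsBoundedFun fun S => P S - Q S := by
    simpa [sub_eq_add_neg] using hPb.add (hQb.const_mul (-1))
  have hEF : ∫ S, (P S - Q S) ∂(Measure.pi fun _ => μ) ≤ 0 := by
    rw [integral_sub (hPm.integrable_of_isBoundedFun hPb) (hQm.integrable_of_isBoundedFun hQb),
      sub_nonpos]
    simpa only [zero_add] using integral_iSup_sum_integral_sub_le hf hM (n := n)
      (A := fun _ => 0) (μ := μ) ⟨0, fun _ => by simp⟩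
  -- Changing one example moves `P` by at most `M` and `Q`, whose summands carry a factor 2, by at
  -- most `2 * M`.
  have hdiff : ∀ S i z, |(P (Function.update S i z) - Q (Function.update S i z)) - (P S - Q S)|
      ≤ 3 * M := by
    intro S i z
    have h1 : |P (Function.update S i z) - P S| ≤ M := by
      refine abs_iSup_sub_iSup_le (IsBoundedFun.bddAbove ⟨_, hPb' _⟩)
        (IsBoundedFun.bddAbove ⟨_, hPb' _⟩) fun k => ?_
      rw [sum_update_sub_sum (fun _ z' => ∫ z, f k z ∂μ - f k z')]
      have := hfd k (S i) z
      convert this using 2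
      ring
    have h2 : |Q (Function.update S i z) - Q S| ≤ 2 * M := by
      simp only [hQ]
      rw [← Finset.expect_sub_distrib]
      refine abs_expect_le fun ε => ?_
      refine abs_iSup_sub_iSup_le (IsBoundedFun.bddAbove ⟨_, hQb' _ _⟩)
        (IsBoundedFun.bddAbove ⟨_, hQb' _ _⟩) fun k => ?_
      rw [sum_update_sub_sum (fun i z' => 2 * boolSign (ε i) * f k z'), ← mul_sub, abs_mul,
        abs_mul, abs_boolSign]
      norm_num
      exact hfd k _ _
    have h3 := abs_sub (P (Function.update S i z) - P S) (Q (Function.update S i z) - Q S)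
    have h4 : (P (Function.update S i z) - Q (Function.update S i z)) - (P S - Q S)
        = (P (Function.update S i z) - P S) - (Q (Function.update S i z) - Q S) := by ring
    rw [h4]
    linarith
  have hs : 0 ≤ 3 * M * n * t := by positivity
  have hmc := measureReal_ge_le_of_bounded_differences (μ := μ) (hPm.sub hQm) hFb hdiff hs
  have hexp : -(3 * M * n * t) ^ 2 / (n * (3 * M) ^ 2 / 2) = -(2 * n * t ^ 2) := by
    have : (n : ℝ) ≠ 0 := by exact_mod_cast hn.ne'
    field_simp
  rw [hexp] at hmc
  refine (measure_mono ?_).trans (ENNReal.le_ofReal_iff_toReal_le (measure_ne_top _ _)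
    (Real.exp_pos _).le |>.2 hmc)
  rintro S ⟨k, hk⟩
  have h1 := IsBoundedFun.le_iSup ⟨_, hPb' S⟩ k
  change 3 * M * n * t ≤ (P S - Q S) - ∫ S, (P S - Q S) ∂(Measure.pi fun _ => μ)
  have h2 : Q S + 3 * M * n * t < P S := hk.trans_le h1
  linarith

/-! ### Margin losses: regularity and domination of the true loss -/

section MarginLosses

variable {X ι : Type*} {l : ι → ℕ} {𝒴 : (t : ι) → Fin (l t) → Type*}

instance : DiscreteMeasurableSpace (Output l 𝒴) := ⟨fun _ => trivial⟩

instance [Countable ι] [∀ t k, Fintype (𝒴 t k)] : Countable (Output l 𝒴) :=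
  inferInstanceAs (Countable (Σ t : ι, (k : Fin (l t)) → 𝒴 t k))

/-- Finiteness makes the real supremum over competitors a true maximum, or 0 if there are none. -/
instance [∀ t k, Fintype (𝒴 t k)] (t : ι) (y : Output l 𝒴) :
    Finite {y' : Output l 𝒴 // y'.1 = t ∧ y' ≠ y} := by
  refine Finite.of_surjective (α := {u : (k : Fin (l t)) → 𝒴 t k //
    (⟨t, u⟩ : Output l 𝒴) ≠ y}) (fun u => ⟨⟨t, u.1⟩, rfl, u.2⟩) ?_
  rintro ⟨⟨t', u⟩, rfl, h⟩
  exact ⟨⟨u, h⟩, rfl⟩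

/-- A margin loss whose value at each competitor `y'` is affine in the margin of the correct
output over `y'`. -/
def affineMarginLoss (shape : X → ι) (M : ℝ) (c b : Output l 𝒴 → Output l 𝒴 → ℝ)
    (h : X → Output l 𝒴 → ℝ) (x : X) (y : Output l 𝒴) : ℝ :=
  truncation M (⨆ y' : {y' : Output l 𝒴 // y'.1 = shape x ∧ y' ≠ y},
    (c y'.1 y - b y'.1 y * (h x y - h x y'.1)))

lemma addMarginLoss_eq (shape : X → ι) (L : Output l 𝒴 → Output l 𝒴 → ℝ) (ρ : ℝ)
    (h : X → Output l 𝒴 → ℝ) (x : X) (y : Output l 𝒴) :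
    addMarginLoss shape L ρ h x y
      = affineMarginLoss shape (lossBound L) L (fun _ _ => 1 / ρ) h x y := rfl

lemma multMarginLoss_eq (shape : X → ι) (L : Output l 𝒴 → Output l 𝒴 → ℝ) (ρ : ℝ)
    (h : X → Output l 𝒴 → ℝ) (x : X) (y : Output l 𝒴) :
    multMarginLoss shape L ρ h x y
      = affineMarginLoss shape (lossBound L) L (fun y' y => L y' y / ρ) h x y := by
  unfold multMarginLoss affineMarginLoss
  congr 1
  refine iSup_congr fun y' => ?_
  ring

lemma truncation_nonneg {M : ℝ} (hM : 0 ≤ M) (r : ℝ) : 0 ≤ truncation M r :=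
  le_min hM (le_max_left _ _)

lemma truncation_le (M r : ℝ) : truncation M r ≤ M := min_le_left _ _

lemma continuous_truncation (M : ℝ) : Continuous (truncation M) := by
  unfold truncation
  fun_prop

lemma abs_truncation_sub_le (M r r' : ℝ) : |truncation M r - truncation M r'| ≤ |r - r'| := by
  unfold truncation
  rw [min_comm M, min_comm M]
  refine (abs_min_sub_min_le_max _ _ _ _).trans ?_
  simp only [sub_self, abs_zero]
  refine max_le ?_ (abs_nonneg _)
  refine (abs_max_sub_max_le_max _ _ _ _).trans ?_
  simp

variable {shape : X → ι} {M : ℝ} {c b : Output l 𝒴 → Output l 𝒴 → ℝ}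

lemma abs_iSup_sub_iSup_le_of_finite {T : Type*} [Finite T] {f g : T → ℝ} {d : ℝ} (hd : 0 ≤ d)
    (h : ∀ t, |f t - g t| ≤ d) : |(⨆ t, f t) - ⨆ t, g t| ≤ d := by
  rcases isEmpty_or_nonempty T with hT | hT
  · simpa [Real.iSup_of_isEmpty] using hd
  · exact abs_iSup_sub_iSup_le (Set.finite_range f).bddAbove (Set.finite_range g).bddAbove h

lemma continuous_iSup_of_finite {T W : Type*} [Finite T] [TopologicalSpace W] {f : T → W → ℝ}
    (h : ∀ t, Continuous (f t)) : Continuous fun w => ⨆ t, f t w := by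
  rcases isEmpty_or_nonempty T with hT | hT
  · simpa [Real.iSup_of_isEmpty] using continuous_const
  · have := Fintype.ofFinite T
    simp_rw [← Finset.sup'_univ_eq_ciSup]
    exact Continuous.finset_sup'_apply _ fun t _ => h t

variable [∀ t k, Fintype (𝒴 t k)]

lemma abs_affineMarginLoss_sub_le {κ d : ℝ} (hb : ∀ y' y, 0 ≤ b y' y) (hbκ : ∀ y' y, b y' y ≤ κ)
    {h h' : X → Output l 𝒴 → ℝ} {x : X} {y : Output l 𝒴} (hd : 0 ≤ d)
    (hh : ∀ y' : Output l 𝒴, y'.1 = shape x →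
      |(h x y - h x y') - (h' x y - h' x y')| ≤ d) :
    |affineMarginLoss shape M c b h x y - affineMarginLoss shape M c b h' x y| ≤ κ * d := by
  have hκ : 0 ≤ κ := (hb y y).trans (hbκ y y)
  refine (abs_truncation_sub_le _ _ _).trans
    (abs_iSup_sub_iSup_le_of_finite (mul_nonneg hκ hd) fun y' => ?_)
  rw [sub_sub_sub_cancel_left, ← mul_sub, abs_mul, abs_of_nonneg (hb _ _), abs_sub_comm]
  exact mul_le_mul (hbκ _ _) (hh _ y'.2.1) (abs_nonneg _) hκ

lemma continuous_affineMarginLoss {W : Type*} [TopologicalSpace W]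
    {h : W → X → Output l 𝒴 → ℝ} (hh : ∀ x y, Continuous fun w => h w x y) (x : X)
    (y : Output l 𝒴) : Continuous fun w => affineMarginLoss shape M c b (h w) x y :=
  (continuous_truncation M).comp (continuous_iSup_of_finite fun y' =>
    continuous_const.sub (continuous_const.mul ((hh x y).sub (hh x y'.1))))

/-- The index set of the supremum varies with `x` only through the shape. Outputs and shapes are
countable, so both can be frozen, leaving a countable supremum of measurable functions. -/
lemma measurable_affineMarginLoss [MeasurableSpace X] [Countable ι] [MeasurableSpace ι]
    [DiscreteMeasurableSpace ι] (hshape : Measurable shape) {h : X → Output l 𝒴 → ℝ}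
    (hh : ∀ y, Measurable fun x => h x y) :
    Measurable fun z : X × Output l 𝒴 => affineMarginLoss shape M c b h z.1 z.2 := by
  refine measurable_from_prod_countable_left fun y => ?_
  have h1 : Measurable fun p : ι × X => truncation M
      (⨆ y' : {y' : Output l 𝒴 // y'.1 = p.1 ∧ y' ≠ y},
        (c y'.1 y - b y'.1 y * (h p.2 y - h p.2 y'.1))) := by
    refine measurable_from_prod_countable_right fun t => ?_
    have h2 : Measurable fun x : X => ⨆ y' : {y' : Output l 𝒴 // y'.1 = t ∧ y' ≠ y},
        (c y'.1 y - b y'.1 y * (h x y - h x y'.1)) :=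
      Measurable.iSup fun y' => (((hh y).sub (hh y'.1)).const_mul _).const_sub _
    exact (continuous_truncation M).measurable.comp h2
  exact h1.comp (hshape.prodMk measurable_id)

/-- A wrong prediction is a competitor against which the margin is nonpositive, so its term is at
least its own loss; truncation is harmless because that loss is at most `M`. -/
lemma le_affineMarginLoss_of_isPredictor [MeasurableSpace X] {L : Output l 𝒴 → Output l 𝒴 → ℝ}
    (hM : 0 ≤ M) (hL0 : ∀ y, L y y = 0) (hLM : ∀ y y', L y y' ≤ M) (hb : ∀ y' y, 0 ≤ b y' y)
    {h : X → Output l 𝒴 → ℝ} {g : X → Output l 𝒴} (hg : IsPredictor shape h g) {x : X}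
    {y : Output l 𝒴} (hy : y.1 = shape x) :
    L (g x) y ≤ affineMarginLoss shape M L b h x y := by
  by_cases hgy : g x = y
  · rw [hgy, hL0]
    exact truncation_nonneg hM _
  · obtain ⟨hshape, hmax⟩ := hg.2 x
    have hle := le_ciSup (f := fun y' : {y' : Output l 𝒴 // y'.1 = shape x ∧ y' ≠ y} =>
      L y'.1 y - b y'.1 y * (h x y - h x y'.1)) (Set.finite_range _).bddAbove ⟨g x, hshape, hgy⟩
    refine le_min (hLM _ _) (le_max_of_le_right (le_trans ?_ hle))
    have := mul_nonneg (hb (g x) y) (sub_nonneg.2 (hmax y hy))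
    simp only
    linarith

end MarginLosses

/-! ### Uniform margin bound through the factor decomposition -/

/-- The linear scoring function with weight vector `w`. -/
def linearScore {X Y : Type*} {N : ℕ} (Ψ : X → Y → Fin N → ℝ) (w : Fin N → ℝ) (x : X) (y : Y) : ℝ :=
  ∑ j, w j * Ψ x y j

/-- A sum of differences over factors is controlled by the Euclidean norm of all local values. -/
lemma abs_sum_sub_le_sqrt {F : Type*} [Fintype F] {U : F → Type*} [∀ f, Fintype (U f)]
    (d : ∀ f, U f → ℝ) (p q : ∀ f, U f) :
    |∑ f, (d f (p f) - d f (q f))|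
      ≤ √2 * √(∑ k : Σ f, U f, (√(Fintype.card F) * d k.1 k.2) ^ 2) := by
  classical
  rw [← Real.sqrt_mul (by norm_num)]
  refine Real.abs_le_sqrt ((sq_sum_le_card_mul_sum_sq).trans ?_)
  -- If the two local labellings differ, their squares are distinct terms of the sum over `u`; if
  -- they agree, the difference vanishes.
  have h : ∀ f, (d f (p f) - d f (q f)) ^ 2 ≤ 2 * ∑ u, d f u ^ 2 := by
    intro f
    by_cases hpq : p f = q f
    · rw [hpq, sub_self]
      have : 0 ≤ ∑ u, d f u ^ 2 := Finset.sum_nonneg fun _ _ => sq_nonneg _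
      simpa using this
    · have h1 : d f (p f) ^ 2 + d f (q f) ^ 2 ≤ ∑ u, d f u ^ 2 := by
        rw [← Finset.sum_pair (f := fun u => d f u ^ 2) hpq]
        exact Finset.sum_le_univ_sum_of_nonneg fun _ => sq_nonneg _
      nlinarith [sq_nonneg (d f (p f) + d f (q f))]
  simp_rw [mul_pow, Real.sq_sqrt (Nat.cast_nonneg' (Fintype.card F) : (0 : ℝ) ≤ _)]
  rw [← Finset.mul_sum, Fintype.sum_sigma, Finset.card_univ]
  have h2 := Finset.sum_le_sum fun f (_ : f ∈ Finset.univ) => h f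
  rw [← Finset.mul_sum] at h2
  have := mul_le_mul_of_nonneg_left h2 (Nat.cast_nonneg' (Fintype.card F) : (0 : ℝ) ≤ _)
  linarith

section UniformBound

variable {X ι : Type*} {l : ι → ℕ} {𝒴 : (t : ι) → Fin (l t) → Type*} {shape : X → ι} {N : ℕ}
  {G : GraphFamily 𝒴 shape}

/-- The pairs of a factor node of the graph of `(x, y)` and a local output. -/
abbrev LocalIndex (G : GraphFamily 𝒴 shape) (z : X × Output l 𝒴) :=
  Σ f : (G z.1 z.2).Factor, (G z.1 z.2).LocalOutput (𝒴 (shape z.1)) f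

/-- The factor features, weighted by the square root of the number of factors. -/
def weightedFeature (Ψf : FactorFeatures G N) (z : X × Output l 𝒴) (k : LocalIndex G z)
    (j : Fin N) : ℝ :=
  √((G z.1 z.2).numFactors) * Ψf z.1 z.2 k.1 k.2 j

variable [∀ t k, Fintype (𝒴 t k)] {Ψ : X → Output l 𝒴 → Fin N → ℝ} {Ψf : FactorFeatures G N}

/-- Both outputs have the shape of the input, so both scores decompose along the single graph of
`(x, y)`, and the change in margin is a sum of local differences to which `abs_sum_sub_le_sqrt`
applies. -/
lemma abs_margin_sub_le (hdecomp : Decomposes G Ψ Ψf) (w w' : Fin N → ℝ)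
    {z : X × Output l 𝒴} (hz : z.2.1 = shape z.1) {y' : Output l 𝒴} (hy' : y'.1 = shape z.1) :
    |(linearScore Ψ w z.1 z.2 - linearScore Ψ w z.1 y')
        - (linearScore Ψ w' z.1 z.2 - linearScore Ψ w' z.1 y')|
      ≤ √2 * √(∑ k : LocalIndex G z, (∑ j, w j * weightedFeature Ψf z k j
          - ∑ j, w' j * weightedFeature Ψf z k j) ^ 2) := by
  obtain ⟨x, y⟩ := z
  have key : ∀ v : Output l 𝒴, v.1 = shape x → ∃ v₀ : (k : Fin (l (shape x))) → 𝒴 (shape x) k,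
      v = ⟨shape x, v₀⟩ := by
    rintro ⟨t, v₀⟩ h
    simp only at h
    subst h
    exact ⟨v₀, rfl⟩
  obtain ⟨y₁, hy₁⟩ := key y hz
  obtain ⟨y₂, hy₂⟩ := key y' hy'
  have hscore : ∀ (w : Fin N → ℝ) v₀, linearScore Ψ w x ⟨shape x, v₀⟩
      = ∑ f, ∑ j, w j * Ψf x y f ((G x y).restrict v₀ f) j := by
    intro w v₀
    unfold linearScore
    rw [hdecomp x y hz v₀, Finset.sum_comm]
    refine Finset.sum_congr rfl fun j _ => ?_
    rw [Finset.sum_apply, Finset.mul_sum]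
  have h := abs_sum_sub_le_sqrt (F := (G x y).Factor)
    (U := fun f => (G x y).LocalOutput (𝒴 (shape x)) f)
    (fun f u => ∑ j, w j * Ψf x y f u j - ∑ j, w' j * Ψf x y f u j)
    (fun f => (G x y).restrict y₁ f) (fun f => (G x y).restrict y₂ f)
  have e1 : ∀ w, linearScore Ψ w x y = linearScore Ψ w x ⟨shape x, y₁⟩ := fun w => by
    conv_lhs => rw [hy₁]
  simp only [e1, hy₂, hscore]
  convert h using 2
  · rw [← Finset.sum_sub_distrib, ← Finset.sum_sub_distrib, ← Finset.sum_sub_distrib]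
    exact Finset.sum_congr rfl fun f _ => by ring
  · congr 1
    refine Finset.sum_congr rfl fun k _ => ?_
    congr 1
    rw [mul_sub, Finset.mul_sum, Finset.mul_sum, Fintype.card_fin]
    congr 1 <;> exact Finset.sum_congr rfl fun j _ => by unfold weightedFeature; ring

variable [MeasurableSpace X] [Countable ι] [MeasurableSpace ι] [DiscreteMeasurableSpace ι]
  {D : Measure (X × Output l 𝒴)} [IsProbabilityMeasure D]
  {L : Output l 𝒴 → Output l 𝒴 → ℝ}

open Classical in
/-- A margin bound for linear classes, in terms of a bound on the Rademacher averages of the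
weighted factor features. -/
theorem measure_not_margin_bound_le (hshape : Measurable shape)
    (hD : ∀ᵐ z ∂D, z.2.1 = shape z.1) (hΨ : ∀ y, Measurable fun x => Ψ x y)
    (hdecomp : Decomposes G Ψ Ψf) {M : ℝ} (hL_nonneg : ∀ y y', 0 ≤ L y y')
    (hL0 : ∀ y, L y y = 0) (hLM : ∀ y y', L y y' ≤ M) {b : Output l 𝒴 → Output l 𝒴 → ℝ} {κ : ℝ}
    (hb : ∀ y' y, 0 ≤ b y' y) (hbκ : ∀ y' y, b y' y ≤ κ) {W : Set (Fin N → ℝ)}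
    (hW : W.Nonempty) (hWb : ∀ v : Fin N → ℝ, ∃ B, ∀ w ∈ W, |∑ j, w j * v j| ≤ B)
    {m : ℕ} (hm : 0 < m) {C : (Fin m → X × Output l 𝒴) → ℝ}
    (hC : ∀ (S : Fin m → X × Output l 𝒴) (w : ℕ → W),
      𝔼 η : ∀ i, LocalIndex G (S i) → Bool, ⨆ n, ∑ i, ∑ k, boolSign (η i k)
        * ∑ j, (w n : Fin N → ℝ) j * weightedFeature Ψf (S i) k j ≤ C S)
    {t : ℝ} (ht : 0 ≤ t) :
    (Measure.pi fun _ : Fin m => D) {S | ¬ ∀ w ∈ W, ∀ g, IsPredictor shape (linearScore Ψ w) g →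
        risk D L g ≤ 1 / (m : ℝ) * ∑ i, affineMarginLoss shape M L b (linearScore Ψ w) (S i).1 (S i).2
          + 4 * κ / m * C S + 3 * M * t}
      ≤ ENNReal.ofReal (Real.exp (-(2 * m * t ^ 2))) := by
  have hDne : Nonempty (X × Output l 𝒴) := nonempty_of_isProbabilityMeasure D
  obtain ⟨z₀⟩ := hDne
  have hκ : 0 ≤ κ := (hb z₀.2 z₀.2).trans (hbκ z₀.2 z₀.2)
  have hM : 0 ≤ M := (hL_nonneg z₀.2 z₀.2).trans (hLM _ _)
  have hWne : Nonempty W := hW.to_subtype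
  set ℓ : W → X × Output l 𝒴 → ℝ :=
    fun w z => affineMarginLoss shape M L b (linearScore Ψ w) z.1 z.2 with hℓ
  have hℓm : ∀ w, Measurable (ℓ w) := fun w => measurable_affineMarginLoss hshape fun y =>
    Finset.measurable_fun_sum _ fun j _ => ((measurable_pi_apply j).comp (hΨ y)).const_mul _
  have hℓ0 : ∀ w z, 0 ≤ ℓ w z := fun w z => truncation_nonneg hM _
  have hℓM : ∀ w z, ℓ w z ≤ M := fun w z => truncation_le _ _
  have hℓa : ∀ w z, |ℓ w z| ≤ M := fun w z => by
    rw [abs_of_nonneg (hℓ0 w z)]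
    exact hℓM w z
  have hℓc : ∀ z, Continuous fun w => ℓ w z := fun z =>
    continuous_affineMarginLoss (h := fun w : W => linearScore Ψ w) (fun x y => by
      exact continuous_finsetSum _ fun j _ =>
        ((continuous_apply j).comp continuous_subtype_val).mul continuous_const) z.1 z.2
  have hEc : Continuous fun w => ∫ z, ℓ w z ∂D :=
    continuous_of_dominated (bound := fun _ => M) (fun w => (hℓm w).aestronglyMeasurable)
      (fun w => ae_of_all _ (hℓa w)) (integrable_const _) (ae_of_all _ hℓc)
  -- Countability of the index set is obtained from a dense sequence of weights; continuity of the
  -- loss and of its mean extends the bound to all of `W` afterwards.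
  have hdev := measure_exists_rademacher_add_lt_le (μ := D)
    (f := fun n => ℓ (TopologicalSpace.denseSeq W n)) (fun n => hℓm _) (fun n => hℓ0 _)
    (fun n => hℓM _) hm ht
  -- The decomposition is available only where output and input shapes match, which holds for almost
  -- every sample.
  have hgood : ∀ᵐ S ∂(Measure.pi fun _ : Fin m => D), ∀ i, (S i).2.1 = shape (S i).1 :=
    ae_all_iff.2 fun i => (measurePreserving_eval (fun _ : Fin m => D) i).quasiMeasurePreserving.ae hD
  refine le_trans (measure_mono_ae ?_) hdev
  filter_upwards [hgood] with S hS
  intro hbad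
  by_contra hnot
  refine hbad ?_
  have hnot' : ∀ n, ∑ i, (∫ z, ℓ (TopologicalSpace.denseSeq W n) z ∂D
      - ℓ (TopologicalSpace.denseSeq W n) (S i)) ≤ (𝔼 ε : Fin m → Bool, ⨆ n, ∑ i,
        2 * boolSign (ε i) * ℓ (TopologicalSpace.denseSeq W n) (S i)) + 3 * M * m * t := by
    intro n
    by_contra hlt
    exact hnot ⟨n, not_le.1 hlt⟩
  have hrad : (𝔼 ε : Fin m → Bool, ⨆ n, ∑ i,
      2 * boolSign (ε i) * ℓ (TopologicalSpace.denseSeq W n) (S i)) ≤ 4 * κ * C S := by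
    -- The Lipschitz constant collects 2 from symmetrization, `κ` from the slope in the margin and
    -- `√2` from the factor decomposition; contraction contributes the last `√2`, for a total of `4
    -- * κ`.
    have hcontr := expect_iSup_le_of_lipschitz_vector (T := ℕ) (C := 2 * (κ * √2)) (by positivity)
      (K := fun i => LocalIndex G (S i)) (A := fun _ => 0)
      (φ := fun i n => 2 * ℓ (TopologicalSpace.denseSeq W n) (S i))
      (a := fun i k n => ∑ j, (TopologicalSpace.denseSeq W n : Fin N → ℝ) j
        * weightedFeature Ψf (S i) k j)
      ⟨0, by simp⟩ (fun i => IsBoundedFun.const_mul ⟨M, fun n => hℓa _ _⟩ 2)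
      (fun i k => by
        obtain ⟨B, hB⟩ := hWb (weightedFeature Ψf (S i) k)
        exact ⟨B, fun n => hB _ (TopologicalSpace.denseSeq W n).2⟩)
      (fun i s t => by
        rw [← mul_sub, abs_mul, abs_of_pos (by norm_num : (0 : ℝ) < 2), mul_assoc, mul_assoc]
        refine mul_le_mul_of_nonneg_left ?_ (by norm_num)
        exact abs_affineMarginLoss_sub_le hb hbκ (by positivity) fun y' hy' =>
          abs_margin_sub_le hdecomp _ _ (hS i) hy')
    simp only [zero_add] at hcontr
    have hsq : √2 * (2 * (κ * √2)) = 4 * κ := by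
      have := Real.mul_self_sqrt (show (0 : ℝ) ≤ 2 by norm_num)
      linear_combination (2 * κ) * this
    rw [hsq] at hcontr
    simp_rw [← Real.mul_iSup_of_nonneg (by positivity : 0 ≤ 4 * κ)] at hcontr
    rw [← Finset.mul_expect] at hcontr
    refine le_trans (le_of_eq ?_) (hcontr.trans
      (mul_le_mul_of_nonneg_left (hC S (TopologicalSpace.denseSeq W)) (by positivity)))
    refine Finset.expect_congr rfl fun ε _ => iSup_congr fun n => Finset.sum_congr rfl fun i _ => ?_
    ring
  have hall : ∀ w : W, ∑ i, (∫ z, ℓ w z ∂D - ℓ w (S i)) ≤ 4 * κ * C S + 3 * M * m * t := by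
    have hclosed : IsClosed {w : W | ∑ i, (∫ z, ℓ w z ∂D - ℓ w (S i))
        ≤ 4 * κ * C S + 3 * M * m * t} :=
      isClosed_le (continuous_finsetSum _ fun i _ => hEc.sub (hℓc (S i))) continuous_const
    intro w
    exact (TopologicalSpace.denseRange_denseSeq W).induction_on w hclosed
      fun n => (hnot' n).trans (by linarith)
  intro w hw g hg
  have hrisk : risk D L g ≤ ∫ z, ℓ ⟨w, hw⟩ z ∂D := by
    have hmeas : Measurable fun z : X × Output l 𝒴 => L (g z.1) z.2 := by
      have h1 : Measurable fun p : Output l 𝒴 × Output l 𝒴 => L p.1 p.2 := measurable_of_countable _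
      exact h1.comp ((hg.1.comp measurable_fst).prodMk measurable_snd)
    refine integral_mono_ae (hmeas.integrable_of_isBoundedFun ⟨M, fun z => ?_⟩)
      ((hℓm _).integrable_of_isBoundedFun ⟨M, hℓa _⟩) ?_
    · rw [abs_of_nonneg (hL_nonneg _ _)]
      exact hLM _ _
    · filter_upwards [hD] with z hz
      exact le_affineMarginLoss_of_isPredictor hM hL0 hLM hb hg hz
  refine hrisk.trans ?_
  have h1 := hall ⟨w, hw⟩
  rw [Finset.sum_sub_distrib, Finset.sum_const, Finset.card_univ, Fintype.card_fin,
    nsmul_eq_mul] at h1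
  have hm' : (0 : ℝ) < m := by exact_mod_cast hm
  have h2 : ∫ z, ℓ ⟨w, hw⟩ z ∂D
      ≤ (∑ i, ℓ ⟨w, hw⟩ (S i) + 4 * κ * C S + 3 * M * m * t) / m := by
    rw [le_div_iff₀ hm']
    linarith
  refine h2.trans (le_of_eq ?_)
  simp only [hℓ]
  field_simp

end UniformBound

/-! ### Rademacher averages of linear classes -/

section LinearClasses

variable {I : Type*} [Fintype I] {K : I → Type*} [∀ i, Fintype (K i)] {N : ℕ}

lemma sum_boolSign_mul_sum (η : ∀ i, K i → Bool) (v : ∀ i, K i → Fin N → ℝ) (w : Fin N → ℝ) :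
    ∑ i, ∑ k, boolSign (η i k) * ∑ j, w j * v i k j
      = ∑ j, w j * ∑ p : Σ i, K i, boolSign (η p.1 p.2) * v p.1 p.2 j := by
  rw [← Fintype.sum_sigma (fun p : Σ i, K i => boolSign (η p.1 p.2) * ∑ j, w j * v p.1 p.2 j)]
  simp_rw [Finset.mul_sum]
  rw [Finset.sum_comm]
  exact Finset.sum_congr rfl fun j _ => Finset.sum_congr rfl fun p _ => by ring

variable [DecidableEq I] [∀ i, DecidableEq (K i)]

/-- Rademacher average of a linear class with `ℓ¹`-bounded weights. -/
theorem expect_iSup_linear_le_of_l1 (v : ∀ i, K i → Fin N → ℝ) {Λ σ : ℝ} (hσ : 0 ≤ σ)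
    (w : ℕ → Fin N → ℝ) (hw : ∀ n, ∑ j, |w n j| ≤ Λ) (hv : ∀ j, ∑ i, ∑ k, v i k j ^ 2 ≤ σ ^ 2) :
    𝔼 η : ∀ i, K i → Bool, ⨆ n, ∑ i, ∑ k, boolSign (η i k) * ∑ j, w n j * v i k j
      ≤ Λ * (σ * √(2 * Real.log (2 * N))) := by
  have hΛ : 0 ≤ Λ := (Finset.sum_nonneg fun _ _ => abs_nonneg _).trans (hw 0)
  rcases isEmpty_or_nonempty (Fin N) with hN | hN
  · simp only [Finset.univ_eq_empty, Finset.sum_empty, mul_zero, Finset.sum_const_zero,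
      ciSup_const, Fintype.expect_const]
    positivity
  have hmax := expect_iSup_abs_sum_boolSign_le (J := Fin N)
    (fun (p : Σ i, K i) j => v p.1 p.2 j) hσ (fun j => by
      rw [Fintype.sum_sigma]
      exact hv j)
  rw [Fintype.card_fin] at hmax
  refine le_trans ?_ (mul_le_mul_of_nonneg_left hmax hΛ)
  rw [expect_curry, Finset.mul_expect]
  refine Finset.expect_le_expect fun x _ => ciSup_le fun n => ?_
  rw [sum_boolSign_mul_sum]
  set V : Fin N → ℝ := fun j => ∑ p : Σ i, K i, boolSign (x p) * v p.1 p.2 j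
  calc ∑ j, w n j * V j ≤ ∑ j, |w n j| * ⨆ j, |V j| := by
        refine Finset.sum_le_sum fun j _ => (le_abs_self _).trans ?_
        rw [abs_mul]
        exact mul_le_mul_of_nonneg_left (le_ciSup (f := fun j => |V j|)
          (Set.finite_range _).bddAbove j) (abs_nonneg _)
    _ ≤ Λ * ⨆ j, |V j| := by
        rw [← Finset.sum_mul]
        exact mul_le_mul_of_nonneg_right (hw n) (Real.iSup_nonneg fun _ => abs_nonneg _)

/-- Rademacher average of a linear class with `ℓ²`-bounded weights. -/
theorem expect_iSup_linear_le_of_l2 (v : ∀ i, K i → Fin N → ℝ) {Λ : ℝ}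
    (w : ℕ → Fin N → ℝ) (hw : ∀ n, √(∑ j, w n j ^ 2) ≤ Λ) :
    𝔼 η : ∀ i, K i → Bool, ⨆ n, ∑ i, ∑ k, boolSign (η i k) * ∑ j, w n j * v i k j
      ≤ Λ * √(∑ i, ∑ k, ∑ j, v i k j ^ 2) := by
  have hΛ : 0 ≤ Λ := (Real.sqrt_nonneg _).trans (hw 0)
  have hmax := expect_sqrt_sum_sq_boolSign_le (fun (p : Σ i, K i) j => v p.1 p.2 j)
  rw [Fintype.sum_sigma] at hmax
  refine le_trans ?_ (mul_le_mul_of_nonneg_left hmax hΛ)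
  rw [expect_curry, Finset.mul_expect]
  refine Finset.expect_le_expect fun x _ => ciSup_le fun n => ?_
  rw [sum_boolSign_mul_sum]
  exact (Real.sum_mul_le_sqrt_mul_sqrt _ _ _).trans
    (mul_le_mul_of_nonneg_right (hw n) (Real.sqrt_nonneg _))

end LinearClasses

/-! ### Feature norms, sparsity and graph size -/

section Features

variable {X ι : Type*} {l : ι → ℕ} {𝒴 : (t : ι) → Fin (l t) → Type*} {shape : X → ι} {N : ℕ}
  {G : GraphFamily 𝒴 shape} {Ψf : FactorFeatures G N} {m : ℕ} {S : Fin m → X × Output l 𝒴}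

lemma featureRadius_nonneg (q : ENNReal) [Fact (1 ≤ q)] : 0 ≤ featureRadius q Ψf S :=
  Real.iSup_nonneg fun _ => Real.iSup_nonneg fun _ => Real.iSup_nonneg fun _ => norm_nonneg _

variable [∀ t k, Fintype (𝒴 t k)]

lemma norm_le_featureRadius (q : ENNReal) (i : Fin m) (k : LocalIndex G (S i)) :
    ‖(WithLp.toLp q (Ψf (S i).1 (S i).2 k.1 k.2) : PiLp q fun _ : Fin N => ℝ)‖
      ≤ featureRadius q Ψf S := by
  refine le_trans ?_ (le_ciSup (Set.finite_range _).bddAbove i)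
  refine le_trans ?_ (le_ciSup (Set.finite_range _).bddAbove k.1)
  exact le_ciSup (f := fun u => ‖(WithLp.toLp q (Ψf (S i).1 (S i).2 k.1 u) :
    PiLp q fun _ : Fin N => ℝ)‖) (Set.finite_range _).bddAbove k.2

/-- Each nonzero coordinate is at most the radius in absolute value and vanishing ones contribute
nothing; the weighted number of nonzero ones is what the sparsity factor maximizes over `j`. -/
lemma sum_weightedFeature_sq_le_sparsityFactor (j : Fin N) :
    ∑ i, ∑ k, weightedFeature Ψf (S i) k j ^ 2
      ≤ (featureRadius ⊤ Ψf S * √(sparsityFactor Ψf S)) ^ 2 := by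
  have hs : 0 ≤ sparsityFactor Ψf S := Real.iSup_nonneg fun _ => Finset.sum_nonneg fun _ _ =>
    Finset.sum_nonneg fun _ _ => Finset.sum_nonneg fun _ _ => by split_ifs <;> positivity
  rw [mul_pow, Real.sq_sqrt hs]
  unfold sparsityFactor
  refine le_trans ?_ (mul_le_mul_of_nonneg_left
    (le_ciSup (Set.finite_range _).bddAbove j) (sq_nonneg _))
  rw [Finset.mul_sum]
  refine Finset.sum_le_sum fun i _ => ?_
  rw [Fintype.sum_sigma, Finset.mul_sum]
  refine Finset.sum_le_sum fun f _ => ?_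
  rw [Finset.mul_sum]
  refine Finset.sum_le_sum fun u _ => ?_
  unfold weightedFeature
  rw [mul_pow, Real.sq_sqrt (Nat.cast_nonneg _)]
  split_ifs with h
  · rw [mul_comm]
    refine mul_le_mul_of_nonneg_right ?_ (Nat.cast_nonneg _)
    refine sq_le_sq' ?_ ?_
    all_goals
      have h1 := norm_le_featureRadius (Ψf := Ψf) (S := S) ⊤ i ⟨f, u⟩
      have h2 := PiLp.norm_apply_le (WithLp.toLp ⊤ (Ψf (S i).1 (S i).2 f u) :
        PiLp ⊤ fun _ : Fin N => ℝ) j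
      rw [Real.norm_eq_abs] at h2
      have h3 := abs_le.1 (h2.trans h1)
      first | exact h3.1 | exact h3.2
  · rw [not_not] at h
    simp [h]

lemma sum_weightedFeature_sq_le_graphSize :
    ∑ i, ∑ k, ∑ j, weightedFeature Ψf (S i) k j ^ 2 ≤ featureRadius 2 Ψf S ^ 2 * graphSize G S := by
  unfold graphSize
  rw [Finset.mul_sum]
  refine Finset.sum_le_sum fun i _ => ?_
  rw [Fintype.sum_sigma, Finset.mul_sum]
  refine Finset.sum_le_sum fun f _ => ?_
  rw [Finset.mul_sum]
  refine Finset.sum_le_sum fun u _ => ?_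
  unfold weightedFeature
  simp_rw [mul_pow, Real.sq_sqrt (Nat.cast_nonneg _), ← Finset.mul_sum]
  rw [mul_comm]
  refine mul_le_mul_of_nonneg_right ?_ (Nat.cast_nonneg _)
  have h1 := norm_le_featureRadius (Ψf := Ψf) (S := S) 2 i ⟨f, u⟩
  rw [PiLp.norm_eq_of_L2] at h1
  have h2 := (Real.sqrt_le_iff.1 h1).2
  simpa using h2

end Features

/-! ### Joint additive and multiplicative bounds -/

section Corollary

variable {X ι : Type*} {l : ι → ℕ} {𝒴 : (t : ι) → Fin (l t) → Type*} {shape : X → ι} {N : ℕ}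
  {G : GraphFamily 𝒴 shape} [∀ t k, Fintype (𝒴 t k)] {Ψ : X → Output l 𝒴 → Fin N → ℝ}
  {Ψf : FactorFeatures G N}
  [MeasurableSpace X] [Countable ι] [MeasurableSpace ι] [DiscreteMeasurableSpace ι]
  {D : Measure (X × Output l 𝒴)} [IsProbabilityMeasure D]
  {L : Output l 𝒴 → Output l 𝒴 → ℝ}

open Classical in
/-- The additive and the multiplicative margin bound hold simultaneously for a linear class. -/
theorem measure_not_add_and_mult_margin_bound_le (hshape : Measurable shape)
    (hD : ∀ᵐ z ∂D, z.2.1 = shape z.1)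
    (hL_nonneg : ∀ y y', 0 ≤ L y y') (hL_definite : ∀ y y', L y y' = 0 ↔ y = y')
    (hL_bounded : BddAbove (Set.range fun p : Output l 𝒴 × Output l 𝒴 => L p.1 p.2))
    (hΨ : ∀ y, Measurable fun x => Ψ x y) (hdecomp : Decomposes G Ψ Ψf)
    {p : ENNReal} {Λ ρ : ℝ} (hρ : 0 < ρ) {m : ℕ} (hm : 0 < m) {δ : ℝ} (hδ : 0 < δ)
    (hWb : ∀ v : Fin N → ℝ, ∃ B, ∀ w : Fin N → ℝ,
      ‖(WithLp.toLp p w : PiLp p fun _ : Fin N => ℝ)‖ ≤ Λ → |∑ j, w j * v j| ≤ B)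
    {C : (Fin m → X × Output l 𝒴) → ℝ}
    (hC : ∀ (S : Fin m → X × Output l 𝒴) (w : ℕ → Fin N → ℝ),
      (∀ n, ‖(WithLp.toLp p (w n) : PiLp p fun _ : Fin N => ℝ)‖ ≤ Λ) →
      𝔼 η : ∀ i, LocalIndex G (S i) → Bool, ⨆ n, ∑ i, ∑ k, boolSign (η i k)
        * ∑ j, w n j * weightedFeature Ψf (S i) k j ≤ √2 * C S) :
    (Measure.pi fun _ : Fin m => D)
        {S | ¬ ∀ h ∈ linearClass p Ψ Λ, ∀ g, IsPredictor shape h g →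
          risk D L g ≤ empAddMarginLoss shape L ρ S h + 4 * √2 / (ρ * m) * C S
              + 3 * lossBound L * √(Real.log (2 / δ) / (2 * m)) ∧
          risk D L g ≤ empMultMarginLoss shape L ρ S h + 4 * √2 * lossBound L / (ρ * m) * C S
              + 3 * lossBound L * √(Real.log (2 / δ) / (2 * m))}
      ≤ ENNReal.ofReal δ := by
  -- For `δ ≥ 1` the claim is trivial; otherwise `log (2 / δ)` is nonnegative, so squaring its root
  -- is legitimate.
  rcases le_or_gt 1 δ with h1 | h1
  · exact prob_le_one.trans (ENNReal.one_le_ofReal.2 h1)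
  set W : Set (Fin N → ℝ) := {w | ‖(WithLp.toLp p w : PiLp p fun _ : Fin N => ℝ)‖ ≤ Λ} with hWdef
  have hclass : ∀ h, h ∈ linearClass p Ψ Λ ↔ ∃ w ∈ W, h = linearScore Ψ w := fun h => Iff.rfl
  rcases W.eq_empty_or_nonempty with hW | hW
  · have hempty : ∀ h, h ∉ linearClass p Ψ Λ := by simp [hclass, hW]
    simp [hempty]
  have hLM : ∀ y y', L y y' ≤ lossBound L := fun y y' => le_ciSup hL_bounded (y, y')
  have hL0 : ∀ y, L y y = 0 := fun y => (hL_definite y y).2 rfl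
  obtain ⟨t, ht⟩ : ∃ t, t = √(Real.log (2 / δ) / (2 * m)) := ⟨_, rfl⟩
  have ht0 : 0 ≤ t := ht ▸ Real.sqrt_nonneg _
  rw [← ht]
  have hm' : (0 : ℝ) < m := by exact_mod_cast hm
  -- Each of the two margin losses is allotted failure probability `δ / 2`.
  have hexp : Real.exp (-(2 * m * t ^ 2)) = δ / 2 := by
    have hlog : 0 ≤ Real.log (2 / δ) := Real.log_nonneg (by rw [le_div_iff₀ hδ]; linarith)
    rw [ht, Real.sq_sqrt (by positivity), mul_div_cancel₀ _ (by positivity), Real.exp_neg,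
      Real.exp_log (by positivity), inv_div]
  have hbound := fun (b : Output l 𝒴 → Output l 𝒴 → ℝ) (κ : ℝ) (hb : ∀ y' y, 0 ≤ b y' y)
      (hbκ : ∀ y' y, b y' y ≤ κ) => measure_not_margin_bound_le (Ψf := Ψf) hshape hD hΨ hdecomp
    hL_nonneg hL0 hLM hb hbκ hW hWb hm (C := fun S => √2 * C S)
    (fun S w => hC S (fun n => w n) fun n => (w n).2) ht0
  rw [hexp] at hbound
  -- The margin enters with slope `1 / ρ` in the additive loss and with slope at most `lossBound L /
  -- ρ` in the multiplicative one; this is the only difference between the two complexity terms.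
  have hadd := hbound (fun _ _ => 1 / ρ) (1 / ρ) (fun _ _ => by positivity) fun _ _ => le_rfl
  have hmult := hbound (fun y' y => L y' y / ρ) (lossBound L / ρ)
    (fun y' y => div_nonneg (hL_nonneg _ _) hρ.le)
    (fun y' y => div_le_div_of_nonneg_right (hLM _ _) hρ.le)
  have hsum : ENNReal.ofReal δ = ENNReal.ofReal (δ / 2) + ENNReal.ofReal (δ / 2) := by
    rw [← ENNReal.ofReal_add (by positivity) (by positivity), add_halves]
  rw [hsum]
  refine le_trans (measure_mono ?_) ((measure_union_le _ _).trans (add_le_add hadd hmult))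
  intro S hS
  by_contra hnot
  rw [Set.mem_union, not_or] at hnot
  refine hS ?_
  intro h hh g hg
  obtain ⟨w, hw, rfl⟩ := (hclass h).1 hh
  have e1 := not_not.1 hnot.1 w hw g hg
  have e2 := not_not.1 hnot.2 w hw g hg
  constructor
  · refine e1.trans (le_of_eq ?_)
    simp only [empAddMarginLoss, addMarginLoss_eq]
    field_simp
  · refine e2.trans (le_of_eq ?_)
    simp only [empMultMarginLoss, multMarginLoss_eq]
    field_simp

end Corollary
end

theorem corollary9 {X ι : Type*} [MeasurableSpace X]
    [Countable ι] [MeasurableSpace ι] [DiscreteMeasurableSpace ι]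
    (l : ι → ℕ) (𝒴 : (t : ι) → Fin (l t) → Type*)
    [∀ t k, Fintype (𝒴 t k)] [∀ t k, Nonempty (𝒴 t k)]
    (shape : X → ι) (hshape : Measurable shape)
    (D : Measure (X × Output l 𝒴)) [IsProbabilityMeasure D]
    (hD : ∀ᵐ z ∂D, z.2.1 = shape z.1)
    (L : Output l 𝒴 → Output l 𝒴 → ℝ)
    (hL_nonneg : ∀ y y', 0 ≤ L y y')
    (hL_definite : ∀ y y', L y y' = 0 ↔ y = y')
    (hL_bounded : BddAbove (Set.range fun p : Output l 𝒴 × Output l 𝒴 => L p.1 p.2))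
    {N : ℕ} (G : GraphFamily 𝒴 shape)
    (Ψ : X → Output l 𝒴 → Fin N → ℝ) (hΨ : ∀ y, Measurable fun x => Ψ x y)
    (Ψf : FactorFeatures G N) (hdecomp : Decomposes G Ψ Ψf)
    (Λ₁ Λ₂ ρ : ℝ) (hρ : 0 < ρ) (m : ℕ) (hm : 0 < m) (δ : ℝ) (hδ : 0 < δ) :
    (Measure.pi fun _ : Fin m => D)
        {S | ¬ ∀ h ∈ linearClass 1 Ψ Λ₁, ∀ g, IsPredictor shape h g →
          risk D L g ≤ empAddMarginLoss shape L ρ S h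
              + 4 * √2 / (ρ * m) * Λ₁ * featureRadius ⊤ Ψf S
                * √(sparsityFactor Ψf S * Real.log (2 * N))
              + 3 * lossBound L * √(Real.log (2 / δ) / (2 * m)) ∧
          risk D L g ≤ empMultMarginLoss shape L ρ S h
              + 4 * √2 * lossBound L / (ρ * m) * Λ₁ * featureRadius ⊤ Ψf S
                * √(sparsityFactor Ψf S * Real.log (2 * N))
              + 3 * lossBound L * √(Real.log (2 / δ) / (2 * m))}
      ≤ ENNReal.ofReal δ ∧
    (Measure.pi fun _ : Fin m => D)
        {S | ¬ ∀ h ∈ linearClass 2 Ψ Λ₂, ∀ g, IsPredictor shape h g →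
          risk D L g ≤ empAddMarginLoss shape L ρ S h
              + 4 * √2 / (ρ * m) * Λ₂ * featureRadius 2 Ψf S * √(graphSize G S)
              + 3 * lossBound L * √(Real.log (2 / δ) / (2 * m)) ∧
          risk D L g ≤ empMultMarginLoss shape L ρ S h
              + 4 * √2 * lossBound L / (ρ * m) * Λ₂ * featureRadius 2 Ψf S * √(graphSize G S)
              + 3 * lossBound L * √(Real.log (2 / δ) / (2 * m))}
      ≤ ENNReal.ofReal δ := by
  classical
  constructor
  · have h := measure_not_add_and_mult_margin_bound_le (Ψf := Ψf) (p := 1) (Λ := Λ₁) hshape hD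
      hL_nonneg hL_definite hL_bounded hΨ hdecomp hρ hm hδ
      (fun v => ⟨∑ j, Λ₁ * |v j|, fun w hw => by
        refine (Finset.abs_sum_le_sum_abs _ _).trans (Finset.sum_le_sum fun j _ => ?_)
        rw [abs_mul]
        exact mul_le_mul_of_nonneg_right ((PiLp.norm_apply_le
          (WithLp.toLp 1 w : PiLp 1 fun _ : Fin N => ℝ) j).trans hw) (abs_nonneg _)⟩)
      (C := fun S => Λ₁ * featureRadius ⊤ Ψf S * √(sparsityFactor Ψf S * Real.log (2 * N)))
      (fun S w hw => by
        have hr : 0 ≤ featureRadius ⊤ Ψf S := featureRadius_nonneg _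
        refine (expect_iSup_linear_le_of_l1 (Λ := Λ₁) _ (mul_nonneg hr (Real.sqrt_nonneg _)) w (fun n => ?_)
          sum_weightedFeature_sq_le_sparsityFactor).trans (le_of_eq ?_)
        · have := hw n
          rwa [PiLp.norm_eq_of_L1] at this
        · rw [Real.sqrt_mul (by norm_num), Real.sqrt_mul' _ (by
            -- For `N = 0` the convention `Real.log 0 = 0` applies.
            rcases N.eq_zero_or_pos with rfl | hN
            · simp
            · exact Real.log_nonneg (by
                have : (1 : ℝ) ≤ N := by exact_mod_cast hN
                linarith))]
          ring)
    simpa only [mul_assoc] using h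
  · have h := measure_not_add_and_mult_margin_bound_le (Ψf := Ψf) (p := 2) (Λ := Λ₂) hshape hD
      hL_nonneg hL_definite hL_bounded hΨ hdecomp hρ hm hδ
      (fun v => ⟨∑ j, Λ₂ * |v j|, fun w hw => by
        refine (Finset.abs_sum_le_sum_abs _ _).trans (Finset.sum_le_sum fun j _ => ?_)
        rw [abs_mul]
        exact mul_le_mul_of_nonneg_right ((PiLp.norm_apply_le
          (WithLp.toLp 2 w : PiLp 2 fun _ : Fin N => ℝ) j).trans hw) (abs_nonneg _)⟩)
      (C := fun S => Λ₂ * featureRadius 2 Ψf S * √(graphSize G S))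
      (fun S w hw => by
        have hr : 0 ≤ featureRadius 2 Ψf S := featureRadius_nonneg _
        have hΛ : 0 ≤ Λ₂ := (norm_nonneg _).trans (hw 0)
        refine (expect_iSup_linear_le_of_l2 _ w (Λ := Λ₂) fun n => ?_).trans ?_
        · have := hw n
          rw [PiLp.norm_eq_of_L2] at this
          simpa using this
        · have h1 := Real.sqrt_le_sqrt (sum_weightedFeature_sq_le_graphSize (Ψf := Ψf) (S := S))
          rw [Real.sqrt_mul (sq_nonneg _), Real.sqrt_sq hr] at h1
          have h2 : 0 ≤ Λ₂ * featureRadius 2 Ψf S * √(graphSize G S) := by positivity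
          -- The `ℓ²` average needs no logarithmic maximal inequality, so the factor `√2` common to
          -- both bounds is slack here.
          have h3 : 1 ≤ √2 := Real.one_le_sqrt.2 (by norm_num)
          calc _ ≤ Λ₂ * (featureRadius 2 Ψf S * √(graphSize G S)) :=
                mul_le_mul_of_nonneg_left h1 hΛ
            _ = 1 * (Λ₂ * featureRadius 2 Ψf S * √(graphSize G S)) := by ring
            _ ≤ _ := mul_le_mul_of_nonneg_right h3 h2)
    simpa only [mul_assoc] using h
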